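/- Let $\mathcal O$ be a discrete valuation ring with uniformizer $\pi$ and residue field $k$ of characteristic $\neq 2$ (for example the ring of integers of the completion of the maximal unramified extension of a finite extension of $\mathbb Q_p$, $p$ odd). Let $d=2n\ge 5$ and $l=2r$ with $l>1$ and $d-l>1$, so $n\ge 3$ and $1\le r\le n-1$. Let $Z=\{n-r+1,\dots,n+r\}$ and $Z^c=\{1,\dots,d\}\setminus Z$. Write the generic $d\times d$ matrix $X=(x_{i,j})$ in blocks $$X=\begin{pmatrix}E_1&O_1&E_2\\ B_1&A&B_2\\ E_3&O_2&E_4\end{pmatrix}$$ with rows and columns of sizes $n-r,\,2r,\,n-r$. Let $J_m$ be the $m\times m$ unit antidiagonal matrix, and let $S_0$, $S_1$ be the $d\times d$ antidiagonal matrices with antidiagonal entries $1^{(n-r)},0^{(2r)},1^{(n-r)}$ and $0^{(n-r)},1^{(2r)},0^{(n-r)}$ respectively. Let $I\subset\mathcal O[X]$ be the ideal generated by the $2\times2$ minors of $X$, by $\mathrm{Tr}(X)$, by $\mathrm{Tr}(A)+2\pi$, and by the entries of $$X^2,\quad X^tS_0X-2\pi(S_0X+\pi S_1X),\quad X^tS_1X+2(S_0X+\pi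 S_1X),\quad AJ_{2r}-J_{2r}A^t,\quad B_2J_{n-r}B_1^t-AJ_{2r}.$$ Put $U_{d,l}=\mathrm{Spec}(\mathcal O[X]/I)$, and let $\overline U_{d,l}=\mathrm{Spec}(k\otimes_{\mathcal O}\mathcal O[X]/I)$ be its special fiber. Let $k[B_1|B_2]=k[x_{t,s}]_{t\in Z,\,s\in Z^c}$, and let $\wedge^2(B_1|B_2)$ denote the set of $2\times 2$ minors of the matrix $(B_1|B_2)=(x_{t,s})_{t\in Z,\,s\in Z^c}$. (i) If $r=1$ or $r=n-1$, then $\overline U_{d,l}$ has exactly three irreducible components. (ii) If $1<r<n-1$, then $\overline U_{d,l}$ has exactly two irreducible components. Moreover, the natural map from $k[B_1|B_2]$ to the coordinate ring of $\overline U_{d,l}$ is surjective, so that $\overline U_{d,l}$ is a closed subscheme of $\mathrm{Spec}\,k[B_1|B_2]$, and its irreducible components are exactly the pairwise distinct closed subschemes $V(I_c)$ of $\overline U_{d,l}$ for the following ideals $I_c$ of $k[B_1|B_2]$. Each $I_c$ is prime, and each $V(I_c)$ has dimension $d-2$. * If $r=1$: $I_1=\big((x_{n,j})_{j\in Z^c}\big)$,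 $I_2=\big((x_{n+1,j})_{j\in Z^c}\big)$, and $$I_3=\Big(\sum_{a=1}^{n-1}x_{n,a}x_{n,d+1-a},\ \sum_{a=1}^{n-1}x_{n+1,a}x_{n+1,d+1-a},\ \sum_{a=1}^{n-1}x_{n,a}x_{n+1,d+1-a},\ \wedge^2(B_1|B_2)\Big).$$ * If $r=n-1$: $I_1=\big((x_{i,1})_{i\in Z}\big)$, $I_2=\big((x_{i,d})_{i\in Z}\big)$, and $$I_3=\Big(\sum_{a=2}^{n}x_{a,1}x_{d+1-a,1},\ \sum_{a=2}^{n}x_{a,d}x_{d+1-a,d},\ \sum_{a=2}^{n}x_{a,1}x_{d+1-a,d},\ \wedge^2(B_1|B_2)\Big).$$ * If $1<r<n-1$: $$I_1=\Big(\Big(\sum_{a=n-r+1}^{n}x_{d+1-a,d+1-t}\,x_{a,s}\Big)_{t,s\in Z^c},\ \wedge^2(B_1|B_2)\Big),\quad I_2=\Big(\Big(\sum_{a=1}^{n-r}x_{i,a}\,x_{d+1-j,d+1-a}\Big)_{i,j\in Z},\ \wedge^2(B_1|B_2)\Big).$$ -/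

import Mathlib

open scoped TensorProduct

noncomputable section

namespace OrthogonalChart

/-! ### Index sets

Rows and columns are indexed by `Fin (2 * n)`, so the classical index `i ∈ {1, …, d}` (`d = 2n`)
is the element of value `i - 1`, and `i ↦ d + 1 - i` is `Fin.rev`. -/

/-- `Z = {n - r + 1, …, n + r}`, the middle block of indices (of size `l = 2r`). -/
def Z (n r : ℕ) : Finset (Fin (2 * n)) :=
  Finset.univ.filter fun i => n ≤ (i : ℕ) + r ∧ (i : ℕ) < n + r

/-- `Zᶜ = {1, …, n - r} ∪ {n + r + 1, …, d}`. -/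
def Zc (n r : ℕ) : Finset (Fin (2 * n)) := (Z n r)ᶜ

/-- The first block of indices `{1, …, n - r}`. -/
def lo (n r : ℕ) : Finset (Fin (2 * n)) := Finset.univ.filter fun i => (i : ℕ) + r < n

/-- The last block of indices `{n + r + 1, …, d}`. -/
def hi (n r : ℕ) : Finset (Fin (2 * n)) := Finset.univ.filter fun i => n + r ≤ (i : ℕ)

theorem rev_mem_Z {n r : ℕ} {i : Fin (2 * n)} (h : i ∈ Z n r) : i.rev ∈ Z n r := by
  simp only [Z, Finset.mem_filter, Finset.mem_univ, true_and, Fin.val_rev] at *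
  omega

theorem rev_mem_Zc {n r : ℕ} {i : Fin (2 * n)} (h : i ∈ Zc n r) : i.rev ∈ Zc n r := by
  simp only [Zc, Finset.mem_compl] at *
  intro h'
  exact h (by simpa using rev_mem_Z h')

/-- `i ↦ d + 1 - i` on `Z`. -/
def revZ {n r : ℕ} (i : Z n r) : Z n r := ⟨i.1.rev, rev_mem_Z i.2⟩

/-- `i ↦ d + 1 - i` on `Zᶜ`. -/
def revZc {n r : ℕ} (i : Zc n r) : Zc n r := ⟨i.1.rev, rev_mem_Zc i.2⟩

/-! ### Matrices -/

/-- The entries of a matrix. -/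
def entries {R α β : Type*} (M : Matrix α β R) : Set R := {f | ∃ i j, f = M i j}

/-- The `2 × 2` minors of a matrix. -/
def minors {R α β : Type*} [CommRing R] (M : Matrix α β R) : Set R :=
  {f | ∃ i t j s, f = M i j * M t s - M i s * M t j}

/-- The block of `M` with rows in `s` and columns in `t`. -/
def block {R α : Type*} (M : Matrix α α R) (s t : Finset α) : Matrix s t R :=
  M.submatrix Subtype.val Subtype.val

/-- The unit antidiagonal matrix. -/
def J (R : Type*) [CommRing R] (m : ℕ) : Matrix (Fin m) (Fin m) R :=
  Matrix.of fun i j => if i = j.rev then 1 else 0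

/-- The antidiagonal matrix with antidiagonal entries `1^(n-r), 0^(2r), 1^(n-r)`. -/
def S₀ (R : Type*) [CommRing R] (n r : ℕ) : Matrix (Fin (2 * n)) (Fin (2 * n)) R :=
  Matrix.of fun i j => if i = j.rev ∧ i ∉ Z n r then 1 else 0

/-- The antidiagonal matrix with antidiagonal entries `0^(n-r), 1^(2r), 0^(n-r)`. -/
def S₁ (R : Type*) [CommRing R] (n r : ℕ) : Matrix (Fin (2 * n)) (Fin (2 * n)) R :=
  Matrix.of fun i j => if i = j.rev ∧ i ∈ Z n r then 1 else 0

/-! ### The chart `U_{d,l}` for `d = 2n`, `l = 2r` -/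

section Chart

variable {O : Type*} [CommRing O]

/-- `O[X]`, the polynomial ring in the entries of a `d × d` matrix. -/
abbrev PolyX (O : Type*) [CommRing O] (n : ℕ) : Type _ :=
  MvPolynomial (Fin (2 * n) × Fin (2 * n)) O

/-- The generic `d × d` matrix `X`. -/
def genX (O : Type*) [CommRing O] (n : ℕ) : Matrix (Fin (2 * n)) (Fin (2 * n)) (PolyX O n) :=
  Matrix.of fun i j => MvPolynomial.X (i, j)

/-- The block `A` of `X`. -/
def blockA (O : Type*) [CommRing O] (n r : ℕ) : Matrix (Z n r) (Z n r) (PolyX O n) :=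
  block (genX O n) (Z n r) (Z n r)

/-- The block `B₁` of `X`. -/
def blockB₁ (O : Type*) [CommRing O] (n r : ℕ) : Matrix (Z n r) (lo n r) (PolyX O n) :=
  block (genX O n) (Z n r) (lo n r)

/-- The block `B₂` of `X`. -/
def blockB₂ (O : Type*) [CommRing O] (n r : ℕ) : Matrix (Z n r) (hi n r) (PolyX O n) :=
  block (genX O n) (Z n r) (hi n r)

/-- `J_{2r}`, as the `Z × Z` block of `J_{2n}`. -/
def Jmid (R : Type*) [CommRing R] (n r : ℕ) : Matrix (Z n r) (Z n r) R :=
  block (J R (2 * n)) (Z n r) (Z n r)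

/-- `J_{n-r}`, as the lower left block of `J_{2n}`: rows are indexed by the columns
of `B₂`, columns by the columns of `B₁`. -/
def Jout (R : Type*) [CommRing R] (n r : ℕ) : Matrix (hi n r) (lo n r) R :=
  block (J R (2 * n)) (hi n r) (lo n r)

/-- `I^naive`, generated by the entries of `X²`, the `2 × 2` minors of `X` and the entries of
`Xᵗ S₀ X - 2π (S₀ X + π S₁ X)` and `Xᵗ S₁ X + 2 (S₀ X + π S₁ X)`. -/
def idealNaive (π : O) (n r : ℕ) : Ideal (PolyX O n) :=
  let X := genX O n
  let S0 := S₀ (PolyX O n) n r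
  let S1 := S₁ (PolyX O n) n r
  Ideal.span
    (entries (X * X) ∪ minors X ∪
      entries (X.transpose * S0 * X - (2 * π) • (S0 * X + π • (S1 * X))) ∪
      entries (X.transpose * S1 * X + (2 : O) • (S0 * X + π • (S1 * X))))

/-- `I^add = (Tr X, Tr A + 2π, A J_{2r} - J_{2r} Aᵗ, B₂ J_{n-r} B₁ᵗ - A J_{2r})`. -/
def idealAdd (π : O) (n r : ℕ) : Ideal (PolyX O n) :=
  let A := blockA O n r
  let Jl := Jmid (PolyX O n) n r
  Ideal.span
    ({(genX O n).trace, A.trace + MvPolynomial.C (2 * π)} ∪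
      entries (A * Jl - Jl * A.transpose) ∪
      entries (blockB₂ O n r * Jout (PolyX O n) n r * (blockB₁ O n r).transpose - A * Jl))

/-- The coordinate ring `O[X] / (I^naive + I^add)` of the chart `U_{d,l}`. -/
abbrev ChartRing (π : O) (n r : ℕ) : Type _ :=
  PolyX O n ⧸ (idealNaive π n r ⊔ idealAdd π n r)

variable [IsLocalRing O]

/-- The coordinate ring `k ⊗_O O[X]/I` of the special fiber of `U_{d,l}`. -/
abbrev SpecialFiberRing (π : O) (n r : ℕ) : Type _ :=
  IsLocalRing.ResidueField O ⊗[O] ChartRing π n r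

/-- The special fiber of `U_{d,l}`. -/
abbrev SpecialFiber (π : O) (n r : ℕ) : Type _ := PrimeSpectrum (SpecialFiberRing π n r)

end Chart

/-! ### Ideals in the entries of `(B₁ | B₂)` -/

section Components

/-- `k[B₁|B₂]`, the polynomial ring in the `x_{t,s}` with `t ∈ Z`, `s ∈ Zᶜ`. -/
abbrev PolyB (k : Type*) [CommRing k] (n r : ℕ) : Type _ := MvPolynomial (Z n r × Zc n r) k

variable (k : Type*) [CommRing k] (n r : ℕ)

/-- The generic matrix `(B₁ | B₂)`. -/
def genB : Matrix (Z n r) (Zc n r) (PolyB k n r) := Matrix.of fun i j => MvPolynomial.X (i, j)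

/-- Case `1 < r < n - 1`, first component: generated by
`∑_{a=n-r+1}^{n} x_{d+1-a,d+1-t} x_{a,s}` for `t, s ∈ Zᶜ` and the `2 × 2` minors. -/
def idealMid₁ : Ideal (PolyB k n r) :=
  let x := genB k n r
  Ideal.span
    ({f | ∃ t s, f = ∑ a : Z n r with (a.1 : ℕ) < n, x (revZ a) (revZc t) * x a s} ∪ minors x)

/-- Case `1 < r < n - 1`, second component: generated by
`∑_{a=1}^{n-r} x_{i,a} x_{d+1-j,d+1-a}` for `i, j ∈ Z` and the `2 × 2` minors. -/
def idealMid₂ : Ideal (PolyB k n r) :=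
  let x := genB k n r
  Ideal.span
    ({f | ∃ i j, f = ∑ a : Zc n r with (a.1 : ℕ) < n, x i a * x (revZ j) (revZc a)} ∪ minors x)

/-- Case `r = 1` (so `Z = {n, n+1}`), first component: generated by row `n`. -/
def idealLow₁ : Ideal (PolyB k n r) :=
  Ideal.span {f | ∃ (i : Z n r) (j : Zc n r), (i.1 : ℕ) + 1 = n ∧ f = genB k n r i j}

/-- Case `r = 1`, second component: generated by row `n + 1`. -/
def idealLow₂ : Ideal (PolyB k n r) :=
  Ideal.span {f | ∃ (i : Z n r) (j : Zc n r), (i.1 : ℕ) = n ∧ f = genB k n r i j}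

/-- Case `r = 1`, third component: generated by the three sums
`∑_{a=1}^{n-1} x_{i,a} x_{j,d+1-a}` for `(i, j) = (n, n), (n, n+1), (n+1, n+1)`
and the `2 × 2` minors. -/
def idealLow₃ : Ideal (PolyB k n r) :=
  let x := genB k n r
  Ideal.span
    ({f | ∃ i j : Z n r, i ≤ j ∧
      f = ∑ a : Zc n r with (a.1 : ℕ) < n, x i a * x j (revZc a)} ∪ minors x)

/-- Case `r = n - 1` (so `Zᶜ = {1, d}`), first component: generated by column `1`. -/
def idealHigh₁ : Ideal (PolyB k n r) :=
  Ideal.span {f | ∃ (i : Z n r) (j : Zc n r), (j.1 : ℕ) = 0 ∧ f = genB k n r i j}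

/-- Case `r = n - 1`, second component: generated by column `d`. -/
def idealHigh₂ : Ideal (PolyB k n r) :=
  Ideal.span {f | ∃ (i : Z n r) (j : Zc n r), (j.1 : ℕ) + 1 = 2 * n ∧ f = genB k n r i j}

/-- Case `r = n - 1`, third component: generated by the three sums
`∑_{a=2}^{n} x_{a,s} x_{d+1-a,t}` for `(s, t) = (1, 1), (1, d), (d, d)`
and the `2 × 2` minors. -/
def idealHigh₃ : Ideal (PolyB k n r) :=
  let x := genB k n r
  Ideal.span
    ({f | ∃ s t : Zc n r, s ≤ t ∧
      f = ∑ a : Z n r with (a.1 : ℕ) < n, x a s * x (revZ a) t} ∪ minors x)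

end Components

section Description

variable {O : Type*} [CommRing O] [IsLocalRing O]

/-- The `k`-algebra homomorphism from `k[B₁|B₂]` to the coordinate ring of the special fiber that
sends `x_{t,s}` to the class of the entry `x_{t,s}` of `X`. -/
def fromB (π : O) (n r : ℕ) :
    PolyB (IsLocalRing.ResidueField O) n r →ₐ[IsLocalRing.ResidueField O]
      SpecialFiberRing π n r :=
  MvPolynomial.aeval fun p : Z n r × Zc n r =>
    (1 : IsLocalRing.ResidueField O) ⊗ₜ[O] Ideal.Quotient.mk (idealNaive π n r ⊔ idealAdd π n r) (genX O n p.1 p.2)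

/-- The closed subset of the special fiber cut out by the equations in an ideal of `k[B₁|B₂]`. -/
def locus (π : O) (n r : ℕ) (I : Ideal (PolyB (IsLocalRing.ResidueField O) n r)) :
    Set (SpecialFiber π n r) :=
  PrimeSpectrum.zeroLocus (fromB π n r '' (I : Set (PolyB (IsLocalRing.ResidueField O) n r)))

/-- The ideals `I₁, …, I_m` of `k[B₁|B₂]` define the irreducible components of the special fiber:
the entries of `(B₁|B₂)` embed the special fiber as a closed subscheme of `Spec k[B₁|B₂]` which
contains every `V(I_c)` as a closed subscheme, the `V(I_c)` are pairwise distinct, they are exactly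
the irreducible components, each has dimension `d - 2`, and each `I_c` is prime. -/
structure DefineComponents (π : O) (n r : ℕ) {m : ℕ}
    (I : Fin m → Ideal (PolyB (IsLocalRing.ResidueField O) n r)) : Prop where
  surjective : Function.Surjective (fromB π n r)
  ker_le : ∀ c, RingHom.ker (fromB π n r) ≤ I c
  injective : Function.Injective fun c => locus π n r (I c)
  range_eq : Set.range (fun c => locus π n r (I c)) = irreducibleComponents (SpecialFiber π n r)
  dim_eq : ∀ c, topologicalKrullDim (locus π n r (I c)) = ((2 * n - 2 : ℕ) : WithBot ℕ∞)
  isPrime : ∀ c, (I c).IsPrime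

end Description

end OrthogonalChart

end

/-
Modulo `π` the equations make `X` a matrix of rank at most one that is determined by its block
`B = (B₁|B₂)`. Writing `B = u vᵗ`, the remaining equation is `q(u) q'(v) = 0` for the split
quadratic forms `q` on `k^{2r}` and `q'` on `k^{2(n - r)}`, so the special fiber is the union of
the cones over `{q = 0} × ℙ` and `ℙ × {q' = 0}`. The ideal of such a cone is the kernel of the
Segre map `x_{ij} ↦ uᵢ vⱼ` into a hypersurface ring, which is a domain when the form has rank at
least four; a split form of rank two is a product of two linear forms, and its cone breaks into
two linear spaces.
-/

noncomputable section

namespace OrthogonalChart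

section KrullDim

theorem ringKrullDim_eq_of_isIntegral {R S : Type*} [CommRing R] [CommRing S] [Algebra R S]
    [Algebra.IsIntegral R S] (h : Function.Injective (algebraMap R S)) :
    ringKrullDim S = ringKrullDim R := by
  apply le_antisymm
  · exact Order.krullDim_le_of_strictMono (PrimeSpectrum.comap (algebraMap R S)) fun p q hpq =>
      Ideal.IsIntegral.comap_lt_comap (I := p.asIdeal) (J := q.asIdeal) hpq
  · refine iSup_le fun l => ?_
    have : FaithfulSMul R S := (faithfulSMul_iff_algebraMap_injective R S).2 h
    obtain ⟨P, -, hP, hPl⟩ := Ideal.exists_ideal_over_prime_of_isIntegral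
      (S := S) (RelSeries.head l).asIdeal ⊥ (by
        rw [← RingHom.ker, (RingHom.injective_iff_ker_eq_bot _).1 h]; exact bot_le)
    have : P.LiesOver (RelSeries.head l).asIdeal := ⟨hPl.symm⟩
    obtain ⟨M, hM, -⟩ := Ideal.exists_ltSeries_of_hasGoingUp (S := S) l P
    rw [← hM]
    exact le_iSup (fun p : LTSeries (PrimeSpectrum S) => ((p.length : ℕ∞) : WithBot ℕ∞)) M

theorem ringKrullDim_eq_card_of_isTranscendenceBasis {k D ι : Type*} [Field k] [CommRing D]
    [IsDomain D] [Algebra k D] [Algebra.FiniteType k D] {x : ι → D}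
    (hx : IsTranscendenceBasis k x) : ringKrullDim D = Nat.card ι := by
  obtain ⟨s, g, hg, hint⟩ := exists_integral_inj_algHom_of_fg k D
  let _ : Algebra (MvPolynomial (Fin s) k) D := g.toRingHom.toAlgebra
  have : IsScalarTower k (MvPolynomial (Fin s) k) D :=
    IsScalarTower.of_algebraMap_eq fun c => (g.commutes c).symm
  have : Algebra.IsIntegral (MvPolynomial (Fin s) k) D := ⟨hint⟩
  have : FaithfulSMul (MvPolynomial (Fin s) k) D :=
    (faithfulSMul_iff_algebraMap_injective _ _).2 hg
  have hX : IsTranscendenceBasis k (algebraMap (MvPolynomial (Fin s) k) D ∘ MvPolynomial.X) :=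
    (IsTranscendenceBasis.mvPolynomial (Fin s) k).algebraMap_comp
  have hcard : Nat.card ι = Nat.card (Fin s) := by
    simpa only [Cardinal.toNat_lift, Nat.card] using
      congrArg Cardinal.toNat (hx.lift_cardinalMk_eq hX)
  rw [ringKrullDim_eq_of_isIntegral (R := MvPolynomial (Fin s) k) hg,
    MvPolynomial.ringKrullDim_of_isNoetherianRing, ringKrullDim_eq_zero_of_field, zero_add, hcard]

end KrullDim

section RankOne

variable {α β : Type*} {R S F : Type*} [CommRing R] [CommRing S]

/-- All `2 × 2` minors of the matrix `M` vanish, that is, `M` has rank at most one. -/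
def MinorsVanish (M : Matrix α β R) : Prop :=
  ∀ i i' j j', M i j * M i' j' = M i j' * M i' j

theorem minorsVanish_vecMulVec (u : α → R) (v : β → R) :
    MinorsVanish (Matrix.vecMulVec u v) :=
  fun i i' j j' => by simp only [Matrix.vecMulVec_apply]; ring

theorem minors_subset_ker_iff [FunLike F R S] [RingHomClass F R S] {φ : F} {M : Matrix α β R} :
    minors M ⊆ RingHom.ker φ ↔ MinorsVanish (M.map φ) := by
  constructor
  · intro h i i' j j'
    have hmem : M i j * M i' j' - M i j' * M i' j ∈ RingHom.ker φ := h ⟨i, i', j, j', rfl⟩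
    simpa only [RingHom.mem_ker, map_sub, map_mul, sub_eq_zero, Matrix.map_apply] using hmem
  · rintro h _ ⟨i, i', j, j', rfl⟩
    simpa only [SetLike.mem_coe, RingHom.mem_ker, map_sub, map_mul, sub_eq_zero,
      Matrix.map_apply] using h i i' j j'

/-- The quadratic form `∑_{a ∈ L} u_a u_{τ a}`. -/
def quadForm (L : Finset α) (τ : α → α) (u : α → R) : R :=
  ∑ a ∈ L, u a * u (τ a)

/-- The ideal of matrices of rank at most one all of whose columns are isotropic for
`quadForm L τ` and orthogonal to each other. -/
def quadIdeal (x : Matrix α β R) (L : Finset α) (τ : α → α) : Ideal R :=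
  Ideal.span ({f | ∃ s t, f = ∑ a ∈ L, x a s * x (τ a) t} ∪ minors x)

theorem quadIdeal_le_ker_iff [FunLike F R S] [RingHomClass F R S] {φ : F} {x : Matrix α β R}
    {L : Finset α} {τ : α → α} :
    quadIdeal x L τ ≤ RingHom.ker φ ↔
      (∀ s t, ∑ a ∈ L, x.map φ a s * x.map φ (τ a) t = 0) ∧ MinorsVanish (x.map φ) := by
  rw [quadIdeal, Ideal.span_le, Set.union_subset_iff, minors_subset_ker_iff]
  refine and_congr_left fun _ => ⟨fun h s t => ?_, ?_⟩
  · have hmem : ∑ a ∈ L, x a s * x (τ a) t ∈ RingHom.ker φ := h ⟨s, t, rfl⟩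
    simpa only [RingHom.mem_ker, map_sum, map_mul, Matrix.map_apply] using hmem
  · rintro h _ ⟨s, t, rfl⟩
    simpa only [SetLike.mem_coe, RingHom.mem_ker, map_sum, map_mul, Matrix.map_apply] using h s t

/-- `a ↦ τ a` matches `L` bijectively with a set disjoint from `L`, so that `quadForm L τ` is a
sum of hyperbolic planes. -/
structure IsPairing (L : Finset α) (τ : α → α) : Prop where
  apply_notMem : ∀ a ∈ L, τ a ∉ L
  injOn : Set.InjOn τ L

theorem IsPairing.ne {L : Finset α} {τ : α → α} (h : IsPairing L τ) {a b : α} (ha : a ∈ L)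
    (hb : b ∈ L) : a ≠ τ b :=
  fun hab => h.apply_notMem b hb (hab ▸ ha)

end RankOne

section Segre

open MvPolynomial

variable (k : Type*) [CommRing k] {α β σ : Type*}

/-- The generic `α × β` matrix. The names `e` of its entries make it possible to see a matrix and
its transpose over the same polynomial ring. -/
def genericMatrix (e : α × β ≃ σ) : Matrix α β (MvPolynomial σ k) :=
  Matrix.of fun i j => X (e (i, j))

variable {k} {R : Type*} [CommRing R] [Algebra k R]

/-- Evaluation of polynomials in the entries of a matrix at the rank one matrix `u vᵗ`. -/
def rankOneHom (e : α × β ≃ σ) (u : α → R) (v : β → R) : MvPolynomial σ k →ₐ[k] R :=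
  aeval fun c => u (e.symm c).1 * v (e.symm c).2

@[simp]
theorem rankOneHom_genericMatrix (e : α × β ≃ σ) (u : α → R) (v : β → R) (i : α) (j : β) :
    rankOneHom e u v (genericMatrix k e i j) = u i * v j := by
  simp [rankOneHom, genericMatrix]

theorem map_rankOneHom_genericMatrix (e : α × β ≃ σ) (u : α → R) (v : β → R) :
    (genericMatrix k e).map (rankOneHom e u v) = Matrix.vecMulVec u v :=
  Matrix.ext (rankOneHom_genericMatrix e u v)

theorem quadIdeal_le_ker_rankOneHom_iff (e : α × β ≃ σ) (L : Finset α) (τ : α → α) (u : α → R)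
    (v : β → R) :
    quadIdeal (genericMatrix k e) L τ ≤ RingHom.ker (rankOneHom (k := k) e u v) ↔
      ∀ s t, quadForm L τ u * (v s * v t) = 0 := by
  have hsum : ∀ s t, ∑ a ∈ L, u a * v s * (u (τ a) * v t) = quadForm L τ u * (v s * v t) :=
    fun s t => by
      simp only [quadForm, Finset.sum_mul, mul_mul_mul_comm]
  simp only [quadIdeal_le_ker_iff, map_rankOneHom_genericMatrix, minorsVanish_vecMulVec, and_true,
    Matrix.vecMulVec_apply, hsum]

variable (k)

/-- The Segre map `x_{ij} ↦ uᵢ vⱼ`. -/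
def segre (e : α × β ≃ σ) : MvPolynomial σ k →ₐ[k] MvPolynomial (α ⊕ β) k :=
  rankOneHom e (fun i => X (Sum.inl i)) fun j => X (Sum.inr j)

/-- The polynomial `∑_{a ∈ L} u_a u_{τ a}` in the variables `u`, `v`. -/
def quadPoly (β : Type*) (L : Finset α) (τ : α → α) : MvPolynomial (α ⊕ β) k :=
  quadForm L τ fun a => X (Sum.inl a)

variable {k}

/-- The exponent of the monomial `∏ uᵢ vⱼ`, the product running over the pairs in `s`. -/
def pairExponent (s : Multiset (α × β)) : α ⊕ β →₀ ℕ :=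
  (s.map fun p => Finsupp.single (Sum.inl p.1) 1 + Finsupp.single (Sum.inr p.2) 1).sum

@[simp]
theorem pairExponent_zero : pairExponent (0 : Multiset (α × β)) = 0 := by
  simp [pairExponent]

@[simp]
theorem pairExponent_cons (i : α) (j : β) (s : Multiset (α × β)) :
    pairExponent ((i, j) ::ₘ s) =
      Finsupp.single (Sum.inl i) 1 + (Finsupp.single (Sum.inr j) 1 + pairExponent s) := by
  simp [pairExponent, add_assoc]

theorem exists_cons_of_pairExponent_inl_ne_zero {s : Multiset (α × β)} {i : α}
    (h : pairExponent s (Sum.inl i) ≠ 0) : ∃ j t, s = (i, j) ::ₘ t := by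
  induction s using Multiset.induction with
  | empty => simp at h
  | cons p s ih =>
    obtain ⟨i', j'⟩ := p
    by_cases hi : i' = i
    · exact ⟨j', s, by rw [hi]⟩
    · obtain ⟨j, t, rfl⟩ := ih (by simpa [hi] using h)
      exact ⟨j, (i', j') ::ₘ t, Multiset.cons_swap ..⟩

theorem exists_cons_of_pairExponent_inr_ne_zero {s : Multiset (α × β)} {j : β}
    (h : pairExponent s (Sum.inr j) ≠ 0) : ∃ i t, s = (i, j) ::ₘ t := by
  induction s using Multiset.induction with
  | empty => simp at h
  | cons p s ih =>
    obtain ⟨i', j'⟩ := p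
    by_cases hj : j' = j
    · exact ⟨i', s, by rw [hj]⟩
    · obtain ⟨i, t, rfl⟩ := ih (by simpa [hj] using h)
      exact ⟨i, (i', j') ::ₘ t, Multiset.cons_swap ..⟩

/-- The product of the entries of `y` at the positions in `s`. -/
def entryProd (y : Matrix α β R) (s : Multiset (α × β)) : R :=
  (s.map fun p => y p.1 p.2).prod

@[simp]
theorem entryProd_cons (y : Matrix α β R) (i : α) (j : β) (s : Multiset (α × β)) :
    entryProd y ((i, j) ::ₘ s) = y i j * entryProd y s := by
  simp [entryProd]

theorem entryProd_eq_of_pairExponent_eq {y : Matrix α β R} (hy : MinorsVanish y)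
    {s t : Multiset (α × β)} (h : pairExponent s = pairExponent t) :
    entryProd y s = entryProd y t := by
  induction s using Multiset.induction generalizing t with
  | empty =>
    have ht : t = 0 := by
      by_contra ht
      obtain ⟨⟨i, j⟩, hp⟩ := Multiset.exists_mem_of_ne_zero ht
      obtain ⟨t, rfl⟩ := Multiset.exists_cons_of_mem hp
      exact absurd (DFunLike.congr_fun h.symm (Sum.inl i)) (by simp)
    rw [ht]
  | cons p s ih =>
    obtain ⟨i, j⟩ := p
    obtain ⟨j', t, rfl⟩ := exists_cons_of_pairExponent_inl_ne_zero (s := t) (i := i) (by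
      simp [← h])
    rw [pairExponent_cons, pairExponent_cons] at h
    replace h := add_left_cancel h
    rcases eq_or_ne j' j with rfl | hj
    · rw [entryProd_cons, entryProd_cons, ih (add_left_cancel h)]
    · obtain ⟨i', t, rfl⟩ := exists_cons_of_pairExponent_inr_ne_zero (s := t) (j := j)
        fun h₀ => absurd (DFunLike.congr_fun h (Sum.inr j)) (by simp [hj, h₀])
      have hs : pairExponent s = pairExponent ((i', j') ::ₘ t) := by
        rw [pairExponent_cons] at h ⊢
        refine add_left_cancel (a := Finsupp.single (Sum.inr j) 1) (h.trans ?_)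
        abel
      simp only [entryProd_cons, ih hs, ← mul_assoc, hy i i' j j']

/-- The linear map sending the monomial `∏ uᵢ vⱼ` to `∏ y i j`, and the monomials not of this
form to `0`. For `y` of rank at most one it is a left inverse of the Segre map, composed with
evaluation at `y`. -/
def unsegre (k : Type*) [CommRing k] [Algebra k R] (y : Matrix α β R) :
    MvPolynomial (α ⊕ β) k →ₗ[k] R :=
  (basisMonomials (α ⊕ β) k).constr k (Function.extend pairExponent (entryProd y) 0)

theorem unsegre_monomial (y : Matrix α β R) (m : α ⊕ β →₀ ℕ) :
    unsegre k y (monomial m 1) = Function.extend pairExponent (entryProd y) 0 m :=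
  (basisMonomials (α ⊕ β) k).constr_basis k _ m

theorem unsegre_pairExponent {y : Matrix α β R} (hy : MinorsVanish y) (s : Multiset (α × β)) :
    unsegre k y (monomial (pairExponent s) 1) = entryProd y s := by
  rw [unsegre_monomial]
  exact Function.FactorsThrough.extend_apply (fun _ _ => entryProd_eq_of_pairExponent_eq hy) _ s

theorem segre_entryProd (e : α × β ≃ σ) (s : Multiset (α × β)) :
    segre k e (entryProd (genericMatrix k e) s) = monomial (pairExponent s) 1 := by
  induction s using Multiset.induction with
  | empty => simp [entryProd, pairExponent]
  | cons p s ih =>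
    obtain ⟨i, j⟩ := p
    rw [entryProd_cons, map_mul, ih, segre, rankOneHom_genericMatrix, X, X, pairExponent_cons,
      monomial_mul, monomial_mul, one_mul, one_mul, add_assoc]

theorem exists_monomial_eq_entryProd (e : α × β ≃ σ) (m : σ →₀ ℕ) :
    ∃ s, monomial m (1 : k) = entryProd (genericMatrix k e) s := by
  refine ⟨(Finsupp.toMultiset m).map e.symm, ?_⟩
  rw [monomial_eq, C_1, one_mul, entryProd, Multiset.map_map]
  simp [genericMatrix, Finsupp.toMultiset_map, Finsupp.prod_toMultiset,
    Finsupp.prod_mapDomain_index, pow_add]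

theorem unsegre_segre (e : α × β ≃ σ) {f : MvPolynomial σ k →ₐ[k] R}
    (hf : MinorsVanish ((genericMatrix k e).map f)) (p : MvPolynomial σ k) :
    unsegre k ((genericMatrix k e).map f) (segre k e p) = f p := by
  suffices unsegre k ((genericMatrix k e).map f) ∘ₗ (segre k e).toLinearMap = f.toLinearMap from
    LinearMap.congr_fun this p
  refine (basisMonomials σ k).ext fun m => ?_
  obtain ⟨s, hs⟩ := exists_monomial_eq_entryProd (k := k) e m
  simp only [coe_basisMonomials, hs, LinearMap.comp_apply, AlgHom.toLinearMap_apply,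
    segre_entryProd, unsegre_pairExponent hf]
  simp only [entryProd, map_multiset_prod, Multiset.map_map, Function.comp_def, Matrix.map_apply]

theorem exists_eq_of_pairExponent_eq_add {s : Multiset (α × β)} {a b : α} {m : α ⊕ β →₀ ℕ}
    (h : pairExponent s = Finsupp.single (Sum.inl a) 1 + (Finsupp.single (Sum.inl b) 1 + m)) :
    ∃ j j' t, m = Finsupp.single (Sum.inr j) 1 + (Finsupp.single (Sum.inr j') 1 +
      pairExponent t) := by
  obtain ⟨j, s, rfl⟩ := exists_cons_of_pairExponent_inl_ne_zero (s := s) (i := a) (by simp [h])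
  rw [pairExponent_cons] at h
  replace h := add_left_cancel h
  obtain ⟨j', t, rfl⟩ := exists_cons_of_pairExponent_inl_ne_zero (s := s) (i := b)
    fun h₀ => absurd (DFunLike.congr_fun h.symm (Sum.inl b)) (by simp [h₀])
  refine ⟨j, j', t, add_left_cancel (h.symm.trans ?_)⟩
  rw [pairExponent_cons]
  abel

theorem unsegre_quadPoly_mul {y : Matrix α β R} (hy : MinorsVanish y) {L : Finset α} {τ : α → α}
    (hL : ∀ s t, ∑ a ∈ L, y a s * y (τ a) t = 0) (p : MvPolynomial (α ⊕ β) k) :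
    unsegre k y (quadPoly k β L τ * p) = 0 := by
  suffices unsegre k y ∘ₗ LinearMap.mulLeft k (quadPoly k β L τ) = 0 from
    LinearMap.congr_fun this p
  refine (basisMonomials (α ⊕ β) k).ext fun m => ?_
  have hterm : ∀ a, X (Sum.inl a) * X (Sum.inl (τ a)) * monomial m (1 : k) = monomial
      (Finsupp.single (Sum.inl a) 1 + (Finsupp.single (Sum.inl (τ a)) 1 + m)) 1 := fun a => by
    rw [X, X, monomial_mul, monomial_mul, one_mul, one_mul, add_assoc]
  simp only [coe_basisMonomials, LinearMap.comp_apply, LinearMap.mulLeft_apply, quadPoly, quadForm,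
    Finset.sum_mul, map_sum, hterm, LinearMap.zero_apply]
  by_cases h : ∃ a ∈ L, ∃ s : Multiset (α × β), pairExponent s =
      Finsupp.single (Sum.inl a) 1 + (Finsupp.single (Sum.inl (τ a)) 1 + m)
  · obtain ⟨a, -, s, hs⟩ := h
    obtain ⟨j, j', t, rfl⟩ := exists_eq_of_pairExponent_eq_add hs
    have hpair : ∀ a, Finsupp.single (Sum.inl a) 1 + (Finsupp.single (Sum.inl (τ a)) 1 +
        (Finsupp.single (Sum.inr j) 1 + (Finsupp.single (Sum.inr j') 1 + pairExponent t))) =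
        pairExponent ((a, j) ::ₘ (τ a, j') ::ₘ t) := fun a => by
      simp only [pairExponent_cons]
      abel
    simp only [hpair, unsegre_pairExponent hy, entryProd_cons, ← mul_assoc]
    rw [← Finset.sum_mul, hL, zero_mul]
  · push Not at h
    refine Finset.sum_eq_zero fun a ha => ?_
    rw [unsegre_monomial, Function.extend_apply' _ _ _ fun ⟨s, hs⟩ => h a ha s hs, Pi.zero_apply]

theorem comap_segre_span_quadPoly (e : α × β ≃ σ) (L : Finset α) (τ : α → α) :
    (Ideal.span {quadPoly k β L τ}).comap (segre k e) = quadIdeal (genericMatrix k e) L τ := by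
  apply le_antisymm
  · intro p hp
    obtain ⟨g, hg⟩ := Ideal.mem_span_singleton.1 (Ideal.mem_comap.1 hp)
    set I := quadIdeal (genericMatrix k e) L τ
    have hI : RingHom.ker (Ideal.Quotient.mkₐ k I) = I := Ideal.Quotient.mkₐ_ker k I
    obtain ⟨hquad, hminors⟩ := quadIdeal_le_ker_iff.1 hI.ge
    rw [← hI, RingHom.mem_ker, ← unsegre_segre e hminors p, hg,
      unsegre_quadPoly_mul hminors hquad]
  · refine Ideal.span_le.2 (Set.union_subset ?_ ?_)
    · rintro _ ⟨s, t, rfl⟩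
      refine Ideal.mem_span_singleton.2 ⟨X (Sum.inr s) * X (Sum.inr t), ?_⟩
      simp only [segre, map_sum, map_mul, rankOneHom_genericMatrix, quadPoly, quadForm,
        Finset.sum_mul, mul_mul_mul_comm]
    · have hker : minors (genericMatrix k e) ⊆ RingHom.ker (segre k e) := by
        rw [minors_subset_ker_iff, segre, map_rankOneHom_genericMatrix]
        exact minorsVanish_vecMulVec _ _
      exact hker.trans (Ideal.comap_mono bot_le)

end Segre

section Quadric

open MvPolynomial

variable {k : Type*} [CommRing k] {α β σ : Type*}

theorem prime_rename {ι κ : Type*} {f : ι → κ} (hf : Function.Injective f)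
    {p : MvPolynomial ι k} (hp : Prime p) : Prime (rename f p) := by
  have h : rename f p = rename ((↑) : Set.range f → κ)
      (renameEquiv k (Equiv.ofInjective f hf) p) := by
    rw [renameEquiv_apply, rename_rename]
    rfl
  rw [h, prime_rename_iff]
  exact (MulEquiv.prime_iff (renameEquiv k (Equiv.ofInjective f hf)).toMulEquiv).2 hp

theorem quadPoly_eq_rename (L : Finset α) (τ : α → α) :
    quadPoly k β L τ = rename (Sum.elim (fun a : L => Sum.inl a.1) fun a : L => Sum.inl (τ a))
      (sumSMulXSMulY (Finsupp.equivFunOnFinite.symm fun _ : L => (1 : k))) := by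
  simp [quadPoly, quadForm, sumSMulXSMulY, ← Finset.sum_coe_sort L,
    Finsupp.linearCombination_apply, Finsupp.sum_fintype]

variable {L : Finset α} {τ : α → α}

theorem prime_quadPoly [IsDomain k] [UniqueFactorizationMonoid k] (hτ : IsPairing L τ)
    (hL : L.Nontrivial) : Prime (quadPoly k β L τ) := by
  rw [quadPoly_eq_rename]
  refine prime_rename ?_ (irreducible_sumSMulXSMulY _ ?_ ?_).prime
  · exact Function.Injective.sumElim (Sum.inl_injective.comp Subtype.val_injective)
      (fun a b h => Subtype.ext (hτ.injOn a.2 b.2 (Sum.inl_injective h)))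
      fun a b h => hτ.ne a.2 b.2 (Sum.inl_injective h)
  · obtain ⟨a, ha, b, hb, hab⟩ := hL
    exact ⟨⟨a, ha⟩, by simp, ⟨b, hb⟩, by simp, by simpa using hab⟩
  · obtain ⟨a, ha⟩ := hL.nonempty
    exact fun c hc => isUnit_of_dvd_one (by simpa using hc ⟨a, ha⟩)

theorem isPrime_quadIdeal [IsDomain k] [UniqueFactorizationMonoid k] (e : α × β ≃ σ)
    (hτ : IsPairing L τ) (hL : L.Nontrivial) : (quadIdeal (genericMatrix k e) L τ).IsPrime := by
  have hq : Prime (quadPoly k β L τ) := prime_quadPoly hτ hL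
  have := (Ideal.span_singleton_prime hq.ne_zero).2 hq
  rw [← comap_segre_span_quadPoly]
  exact Ideal.comap_isPrime _ _

end Quadric

section Dimension

open MvPolynomial

variable {k α β σ : Type*} {L : Finset α} {τ : α → α} {a₀ : α}

section IsotropicCompletion

variable {K : Type*} [Field K] [DecidableEq α]

/-- The vector that agrees with `y` outside `τ a₀` and whose coordinate at `τ a₀` is chosen so that
it becomes isotropic for `quadForm L τ`; this needs `y a₀ ≠ 0`. -/
def isotropicCompletion (L : Finset α) (τ : α → α) (a₀ : α) (y : α → K) : α → K :=
  Function.update y (τ a₀) (-(∑ a ∈ L.erase a₀, y a * y (τ a)) / y a₀)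

theorem isotropicCompletion_of_ne {i : α} (hi : i ≠ τ a₀) (y : α → K) :
    isotropicCompletion L τ a₀ y i = y i :=
  Function.update_of_ne hi _ _

theorem quadForm_isotropicCompletion (hτ : IsPairing L τ) (ha₀ : a₀ ∈ L) {y : α → K}
    (hy : y a₀ ≠ 0) : quadForm L τ (isotropicCompletion L τ a₀ y) = 0 := by
  have hrest : ∑ a ∈ L.erase a₀, isotropicCompletion L τ a₀ y a *
      isotropicCompletion L τ a₀ y (τ a) = ∑ a ∈ L.erase a₀, y a * y (τ a) := by
    refine Finset.sum_congr rfl fun a ha => ?_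
    obtain ⟨hne, haL⟩ := Finset.mem_erase.1 ha
    rw [isotropicCompletion_of_ne (hτ.ne haL ha₀),
      isotropicCompletion_of_ne fun h => hne (hτ.injOn haL ha₀ h)]
  rw [quadForm, ← Finset.add_sum_erase L _ ha₀, hrest, isotropicCompletion_of_ne (hτ.ne ha₀ ha₀),
    isotropicCompletion, Function.update_self, mul_div_cancel₀ _ hy, neg_add_cancel]

end IsotropicCompletion

/-- The entries of `x` in column `j₀` outside row `i₀`, and those in row `a₀` outside
column `j₀`. -/
def crossEntries {R : Type*} (x : Matrix α β R) (i₀ a₀ : α) (j₀ : β) :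
    {i // i ≠ i₀} ⊕ {j // j ≠ j₀} → R :=
  Sum.elim (fun i => x i j₀) fun j => x a₀ j

section Algebraic

variable {D : Type*} [CommRing D] [IsDomain D] {x : Matrix α β D}

theorem isAlgebraic_of_crossEntries_mem [CommRing k] [Algebra k D] {A : Subalgebra k D}
    (hx : MinorsVanish x) (hτ : IsPairing L τ) (ha₀ : a₀ ∈ L) {j₀ : β}
    (hiso : quadForm L τ (fun a => x a j₀) = 0) (hx₀ : x a₀ j₀ ≠ 0)
    (hA : ∀ m, crossEntries x (τ a₀) a₀ j₀ m ∈ A) (i : α) (j : β) : IsAlgebraic A (x i j) := by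
  classical
  have hmem : ∀ m, IsAlgebraic A (crossEntries x (τ a₀) a₀ j₀ m) := fun m =>
    isAlgebraic_algebraMap (⟨_, hA m⟩ : A)
  have hcol : ∀ i, i ≠ τ a₀ → IsAlgebraic A (x i j₀) := fun i hi => hmem (Sum.inl ⟨i, hi⟩)
  have hpivot : IsAlgebraic A (x a₀ j₀) := hcol a₀ (hτ.ne ha₀ ha₀)
  have hreg : x a₀ j₀ ∈ nonZeroDivisors D := mem_nonZeroDivisors_of_ne_zero hx₀
  have hcol' : ∀ i, IsAlgebraic A (x i j₀) := by
    intro i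
    by_cases hi : i = τ a₀
    · rw [quadForm, ← Finset.add_sum_erase L _ ha₀] at hiso
      rw [hi]
      refine IsAlgebraic.of_mul hreg hpivot ?_
      rw [eq_neg_of_add_eq_zero_left hiso]
      refine IsAlgebraic.neg ((Subalgebra.algebraicClosure _ _).sum_mem fun a ha => ?_)
      obtain ⟨hne, haL⟩ := Finset.mem_erase.1 ha
      exact (hcol a (hτ.ne haL ha₀)).mul (hcol _ fun h => hne (hτ.injOn haL ha₀ h))
    · exact hcol i hi
  have hrow : ∀ j, IsAlgebraic A (x a₀ j) := by
    intro j
    by_cases hj : j = j₀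
    · rw [hj]
      exact hpivot
    · exact hmem (Sum.inr ⟨j, hj⟩)
  refine IsAlgebraic.of_mul hreg hpivot ?_
  rw [hx, mul_comm]
  exact (hcol' i).mul (hrow j)

end Algebraic

variable [Field k]

theorem algebraicIndependent_crossEntries {D : Type*} [CommRing D] [Algebra k D] (e : α × β ≃ σ)
    (hτ : IsPairing L τ) (ha₀ : a₀ ∈ L) (j₀ : β) {φ : MvPolynomial σ k →ₐ[k] D}
    (hφ : Function.Surjective φ) (hker : RingHom.ker φ = quadIdeal (genericMatrix k e) L τ) :
    AlgebraicIndependent k (crossEntries ((genericMatrix k e).map φ) (τ a₀) a₀ j₀) ∧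
      φ (genericMatrix k e a₀ j₀) ≠ 0 := by
  classical
  let P := MvPolynomial (α ⊕ β) k
  let ξ : α ⊕ β → FractionRing P := fun m => algebraMap P (FractionRing P) (X m)
  have hξ : AlgebraicIndependent k ξ := (algebraicIndependent_X _ k).map'
    (f := IsScalarTower.toAlgHom k P (FractionRing P)) (IsFractionRing.injective _ _)
  have hξ₀ : ξ (Sum.inl a₀) ≠ 0 := hξ.ne_zero _
  let u := isotropicCompletion L τ a₀ fun i => ξ (Sum.inl i)
  let v := Function.update (fun j => ξ (Sum.inr j) / ξ (Sum.inl a₀)) j₀ 1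
  have hu : ∀ i, i ≠ τ a₀ → u i = ξ (Sum.inl i) := fun i hi => isotropicCompletion_of_ne hi _
  have hv : v j₀ = 1 := Function.update_self ..
  have hle : RingHom.ker φ ≤ RingHom.ker (rankOneHom (k := k) e u v) := by
    rw [hker, quadIdeal_le_ker_rankOneHom_iff, quadForm_isotropicCompletion hτ ha₀ hξ₀]
    simp
  let f := AlgHom.liftOfSurjective φ hφ (rankOneHom e u v) hle
  have hf : ∀ i j, f (φ (genericMatrix k e i j)) = u i * v j := fun i j =>
    (AlgHom.liftOfSurjective_apply ..).trans (rankOneHom_genericMatrix ..)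
  constructor
  · refine AlgebraicIndependent.of_comp f ?_
    have hcomp : f ∘ crossEntries ((genericMatrix k e).map φ) (τ a₀) a₀ j₀ =
        ξ ∘ Sum.map Subtype.val Subtype.val := by
      funext m
      rcases m with ⟨i, hi⟩ | ⟨j, hj⟩
      · simp [crossEntries, hf, hu i hi, hv]
      · simp [crossEntries, hf, hu a₀ (hτ.ne ha₀ ha₀), v, hj, mul_div_cancel₀ _ hξ₀]
    rw [hcomp]
    exact hξ.comp _ (Subtype.val_injective.sumMap Subtype.val_injective)
  · intro h₀
    have := hf a₀ j₀
    rw [h₀, map_zero, hu a₀ (hτ.ne ha₀ ha₀), hv, mul_one] at this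
    exact hξ₀ this.symm

theorem isTranscendenceBasis_crossEntries {D : Type*} [CommRing D] [IsDomain D] [Algebra k D]
    (e : α × β ≃ σ) (hτ : IsPairing L τ) (ha₀ : a₀ ∈ L) (j₀ : β) {φ : MvPolynomial σ k →ₐ[k] D}
    (hφ : Function.Surjective φ) (hker : RingHom.ker φ = quadIdeal (genericMatrix k e) L τ) :
    IsTranscendenceBasis k (crossEntries ((genericMatrix k e).map φ) (τ a₀) a₀ j₀) := by
  obtain ⟨hind, hx₀⟩ := algebraicIndependent_crossEntries e hτ ha₀ j₀ hφ hker
  obtain ⟨hquad, hminors⟩ := quadIdeal_le_ker_iff.1 hker.ge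
  rw [hind.isTranscendenceBasis_iff_isAlgebraic]
  set A := Algebra.adjoin k (Set.range (crossEntries ((genericMatrix k e).map φ) (τ a₀) a₀ j₀))
  let C : Subalgebra k D := (Subalgebra.algebraicClosure A D).restrictScalars k
  have htop : ⊤ ≤ C.comap φ := by
    rw [← adjoin_range_X, Algebra.adjoin_le_iff]
    rintro _ ⟨c, rfl⟩
    obtain ⟨⟨i, j⟩, rfl⟩ := e.surjective c
    exact isAlgebraic_of_crossEntries_mem hminors hτ ha₀ (hquad j₀ j₀) hx₀
      (fun m => Algebra.subset_adjoin (Set.mem_range_self m)) i j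
  refine ⟨fun z => ?_⟩
  obtain ⟨p, rfl⟩ := hφ z
  exact htop Algebra.mem_top

theorem ringKrullDim_quotient_quadIdeal [Finite α] [Finite β] [Nonempty β] (e : α × β ≃ σ)
    (hτ : IsPairing L τ) (hL : L.Nontrivial) :
    ringKrullDim (MvPolynomial σ k ⧸ quadIdeal (genericMatrix k e) L τ) =
      ((Nat.card α + Nat.card β - 2 : ℕ) : WithBot ℕ∞) := by
  obtain ⟨a₀, ha₀⟩ := hL.nonempty
  obtain ⟨j₀⟩ := ‹Nonempty β›
  have := isPrime_quadIdeal (k := k) e hτ hL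
  have : Finite σ := Finite.of_equiv _ e
  have := Fintype.ofFinite α
  have := Fintype.ofFinite β
  classical
  have hbasis := isTranscendenceBasis_crossEntries e hτ ha₀ j₀
    (Ideal.Quotient.mkₐ_surjective k (quadIdeal (genericMatrix k e) L τ))
    (Ideal.Quotient.mkₐ_ker k _)
  have hα : 0 < Fintype.card α := Fintype.card_pos_iff.2 ⟨a₀⟩
  have hβ : 0 < Fintype.card β := Fintype.card_pos_iff.2 ⟨j₀⟩
  rw [ringKrullDim_eq_card_of_isTranscendenceBasis hbasis]
  simp only [Nat.card_eq_fintype_card, Fintype.card_sum, Fintype.card_subtype_compl,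
    Fintype.card_subtype_eq]
  congr 2
  omega

end Dimension

section Row

open MvPolynomial

variable {k α β σ : Type*}

theorem ker_killCompl [CommRing k] {ι κ : Type*} {f : ι → κ} (hf : Function.Injective f) :
    RingHom.ker (killCompl (R := k) hf) = Ideal.span (X '' (Set.range f)ᶜ) := by
  apply le_antisymm
  · set I : Ideal (MvPolynomial κ k) := Ideal.span (X '' (Set.range f)ᶜ)
    have hmk : ((Ideal.Quotient.mkₐ k I).comp (rename f)).comp (killCompl hf) =
        Ideal.Quotient.mkₐ k I := by
      ext c
      by_cases hc : c ∈ Set.range f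
      · obtain ⟨i, rfl⟩ := hc
        rw [AlgHom.comp_apply, ← rename_X (R := k) f, killCompl_rename_app, AlgHom.comp_apply]
      · have hXc : X c ∈ I := Ideal.subset_span ⟨c, hc, rfl⟩
        rw [AlgHom.comp_apply, killCompl, aeval_X, dif_neg hc, map_zero]
        exact (Ideal.Quotient.eq_zero_iff_mem.2 hXc).symm
    intro p hp
    have hp' := AlgHom.congr_fun hmk p
    rw [AlgHom.comp_apply, RingHom.mem_ker.1 hp, map_zero] at hp'
    exact Ideal.Quotient.eq_zero_iff_mem.1 hp'.symm
  · rw [Ideal.span_le]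
    rintro _ ⟨c, hc, rfl⟩
    rw [SetLike.mem_coe, RingHom.mem_ker, killCompl, aeval_X, dif_neg hc]

/-- The ideal of matrices whose row `i` vanishes. -/
def rowIdeal {R : Type*} [CommRing R] (M : Matrix α β R) (i : α) : Ideal R :=
  Ideal.span (Set.range (M i))

theorem injective_apply_mk (e : α × β ≃ σ) (i : α) : Function.Injective fun j => e (i, j) :=
  e.injective.comp (Prod.mk_right_injective i)

theorem rowIdeal_eq_ker_killCompl [CommRing k] (e : α × β ≃ σ) {i i' : α} (hi : i ≠ i')
    (hα : ∀ a, a = i ∨ a = i') :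
    rowIdeal (genericMatrix k e) i =
      RingHom.ker (killCompl (R := k) (injective_apply_mk e i')) := by
  rw [ker_killCompl, rowIdeal]
  congr 1
  ext f
  constructor
  · rintro ⟨j, rfl⟩
    exact ⟨e (i, j), by simpa using hi.symm, rfl⟩
  · rintro ⟨c, hc, rfl⟩
    obtain ⟨⟨a, j⟩, rfl⟩ := e.surjective c
    rcases hα a with rfl | rfl
    · exact ⟨j, rfl⟩
    · exact absurd ⟨j, rfl⟩ hc

theorem isPrime_rowIdeal [CommRing k] [IsDomain k] (e : α × β ≃ σ) {i i' : α} (hi : i ≠ i')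
    (hα : ∀ a, a = i ∨ a = i') : (rowIdeal (genericMatrix k e) i).IsPrime := by
  rw [rowIdeal_eq_ker_killCompl e hi hα]
  exact RingHom.ker_isPrime _

theorem ringKrullDim_quotient_rowIdeal [Field k] [Finite β] (e : α × β ≃ σ) {i i' : α}
    (hi : i ≠ i') (hα : ∀ a, a = i ∨ a = i') :
    ringKrullDim (MvPolynomial σ k ⧸ rowIdeal (genericMatrix k e) i) = Nat.card β := by
  have hsurj : Function.Surjective (killCompl (R := k) (injective_apply_mk e i')) := fun p =>
    ⟨_, killCompl_rename_app _ p⟩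
  rw [rowIdeal_eq_ker_killCompl e hi hα,
    ringKrullDim_eq_of_ringEquiv (Ideal.quotientKerAlgEquivOfSurjective hsurj).toRingEquiv,
    MvPolynomial.ringKrullDim_of_isNoetherianRing, ringKrullDim_eq_zero_of_field, zero_add]

end Row

section Index

variable {n r : ℕ}

theorem mem_Z {i : Fin (2 * n)} : i ∈ Z n r ↔ n ≤ (i : ℕ) + r ∧ (i : ℕ) < n + r := by
  simp [Z]

theorem mem_Zc {i : Fin (2 * n)} : i ∈ Zc n r ↔ ¬ (n ≤ (i : ℕ) + r ∧ (i : ℕ) < n + r) := by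
  rw [Zc, Finset.mem_compl, mem_Z]

theorem mem_Zc_iff_notMem_Z {i : Fin (2 * n)} : i ∈ Zc n r ↔ i ∉ Z n r :=
  Finset.mem_compl

theorem card_Z (h : r ≤ n) : Nat.card (Z n r) = 2 * r := by
  have hmap : (Z n r).map Fin.valEmbedding = Finset.Ico (n - r) (n + r) := by
    ext i
    simp only [Finset.mem_map, mem_Z, Fin.valEmbedding_apply, Finset.mem_Ico]
    constructor
    · rintro ⟨a, ha, rfl⟩
      omega
    · exact fun hi => ⟨⟨i, by omega⟩, by simp only; omega, rfl⟩
  rw [Nat.card_eq_fintype_card, Fintype.card_coe, ← Finset.card_map Fin.valEmbedding, hmap,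
    Nat.card_Ico]
  omega

theorem card_Zc (h : r ≤ n) : Nat.card (Zc n r) = 2 * n - 2 * r := by
  have hZ := card_Z h
  rw [Nat.card_eq_fintype_card, Fintype.card_coe] at hZ ⊢
  rw [Zc, Finset.card_compl, Fintype.card_fin, hZ]

theorem sum_eq_sum_Z_add_sum_Zc {T : Type*} [AddCommMonoid T] (f : Fin (2 * n) → T) :
    ∑ a, f a = ∑ a : Z n r, f a + ∑ a : Zc n r, f a := by
  rw [Finset.sum_coe_sort, Finset.sum_coe_sort, Zc, Finset.sum_add_sum_compl]

/-- The first half `{n - r + 1, …, n}` of `Z`. -/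
def halfZ (n r : ℕ) : Finset (Z n r) := Finset.univ.filter fun a => (a.1 : ℕ) < n

/-- The first half `{1, …, n - r}` of `Zᶜ`. -/
def halfZc (n r : ℕ) : Finset (Zc n r) := Finset.univ.filter fun a => (a.1 : ℕ) < n

theorem mem_halfZ {a : Z n r} : a ∈ halfZ n r ↔ (a.1 : ℕ) < n := by
  simp [halfZ]

theorem mem_halfZc {a : Zc n r} : a ∈ halfZc n r ↔ (a.1 : ℕ) < n := by
  simp [halfZc]

theorem involutive_revZ : Function.Involutive (revZ (n := n) (r := r)) :=
  fun _ => Subtype.ext (Fin.rev_rev _)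

theorem involutive_revZc : Function.Involutive (revZc (n := n) (r := r)) :=
  fun _ => Subtype.ext (Fin.rev_rev _)

theorem revZ_mem_halfZ (a : Z n r) : revZ a ∈ halfZ n r ↔ a ∉ halfZ n r := by
  have := a.1.is_lt
  simp only [mem_halfZ, revZ, Fin.val_rev]
  omega

theorem revZc_mem_halfZc (a : Zc n r) : revZc a ∈ halfZc n r ↔ a ∉ halfZc n r := by
  have := a.1.is_lt
  simp only [mem_halfZc, revZc, Fin.val_rev]
  omega

theorem isPairing_of_involutive {α : Type*} {L : Finset α} {τ : α → α}
    (hτ : Function.Involutive τ) (hL : ∀ a, τ a ∈ L ↔ a ∉ L) : IsPairing L τ where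
  apply_notMem a ha h := (hL a).1 h ha
  injOn := hτ.injective.injOn

theorem isPairing_halfZ : IsPairing (halfZ n r) revZ :=
  isPairing_of_involutive involutive_revZ revZ_mem_halfZ

theorem isPairing_halfZc : IsPairing (halfZc n r) revZc :=
  isPairing_of_involutive involutive_revZc revZc_mem_halfZc

theorem sum_eq_sum_half {α T : Type*} [Fintype α] [AddCommMonoid T] {L : Finset α} {τ : α → α}
    (hτ : Function.Involutive τ) (hL : ∀ a, τ a ∈ L ↔ a ∉ L) (f : α → T) :
    ∑ a, f a = ∑ a ∈ L, (f a + f (τ a)) := by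
  classical
  rw [Finset.sum_add_distrib, ← Finset.sum_add_sum_compl L f]
  congr 1
  exact Finset.sum_nbij' τ τ (fun a ha => (hL a).2 (Finset.mem_compl.1 ha))
    (fun a ha => Finset.mem_compl.2 fun h => (hL a).1 h ha) (fun a _ => hτ a) (fun a _ => hτ a)
    fun a _ => by rw [hτ a]

theorem sum_mul_apply_eq_two_mul_quadForm {α R : Type*} [Fintype α] [CommRing R] {L : Finset α}
    {τ : α → α} (hτ : Function.Involutive τ) (hL : ∀ a, τ a ∈ L ↔ a ∉ L) (u : α → R) :
    ∑ a, u a * u (τ a) = 2 * quadForm L τ u := by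
  rw [sum_eq_sum_half hτ hL, quadForm, Finset.mul_sum]
  refine Finset.sum_congr rfl fun a _ => ?_
  rw [hτ a]
  ring

theorem halfZ_nontrivial (h : 2 ≤ r) (h' : r ≤ n) : (halfZ n r).Nontrivial :=
  ⟨⟨⟨n - 1, by omega⟩, mem_Z.2 (by simp only; omega)⟩, mem_halfZ.2 (by simp only; omega),
    ⟨⟨n - 2, by omega⟩, mem_Z.2 (by simp only; omega)⟩, mem_halfZ.2 (by simp only; omega), by
      simp only [ne_eq, Subtype.mk.injEq, Fin.mk.injEq]; omega⟩

theorem halfZc_nontrivial (h : r + 2 ≤ n) : (halfZc n r).Nontrivial :=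
  ⟨⟨⟨0, by omega⟩, mem_Zc.2 (by simp only; omega)⟩, mem_halfZc.2 (by simp only; omega),
    ⟨⟨1, by omega⟩, mem_Zc.2 (by simp only; omega)⟩, mem_halfZc.2 (by simp only; omega), by simp⟩

end Index

section Antidiagonal

variable {n r : ℕ} {R : Type*} [CommRing R] (M : Matrix (Fin (2 * n)) (Fin (2 * n)) R)

theorem S₀_mul_apply (i j : Fin (2 * n)) :
    (S₀ R n r * M) i j = if i ∈ Z n r then 0 else M i.rev j := by
  rw [Matrix.mul_apply, Finset.sum_eq_single i.rev]
  · by_cases h : i ∈ Z n r <;> simp [S₀, h]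
  · intro b _ hb
    have : i ≠ b.rev := fun h => hb (by rw [h, Fin.rev_rev])
    simp [S₀, this]
  · simp

theorem S₁_mul_apply (i j : Fin (2 * n)) :
    (S₁ R n r * M) i j = if i ∈ Z n r then M i.rev j else 0 := by
  rw [Matrix.mul_apply, Finset.sum_eq_single i.rev]
  · by_cases h : i ∈ Z n r <;> simp [S₁, h]
  · intro b _ hb
    have : i ≠ b.rev := fun h => hb (by rw [h, Fin.rev_rev])
    simp [S₁, this]
  · simp

theorem transpose_mul_S₀_mul_apply (i j : Fin (2 * n)) :
    (M.transpose * S₀ R n r * M) i j = ∑ a : Zc n r, M a i * M (revZc a) j := by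
  rw [Matrix.mul_assoc, Matrix.mul_apply, sum_eq_sum_Z_add_sum_Zc (r := r)]
  simp only [S₀_mul_apply, Matrix.transpose_apply, Finset.coe_mem, if_true, mul_zero,
    Finset.sum_const_zero, zero_add]
  exact Finset.sum_congr rfl fun a _ => by rw [if_neg (mem_Zc_iff_notMem_Z.1 a.2), revZc]

theorem transpose_mul_S₁_mul_apply (i j : Fin (2 * n)) :
    (M.transpose * S₁ R n r * M) i j = ∑ a : Z n r, M a i * M (revZ a) j := by
  rw [Matrix.mul_assoc, Matrix.mul_apply, sum_eq_sum_Z_add_sum_Zc (r := r)]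
  simp only [S₁_mul_apply, Matrix.transpose_apply, Finset.coe_mem, if_true, revZ, add_eq_left]
  exact Finset.sum_eq_zero fun a _ => by rw [if_neg (mem_Zc_iff_notMem_Z.1 a.2), mul_zero]

theorem block_mul_Jmid_apply (i j : Z n r) :
    (block M (Z n r) (Z n r) * Jmid R n r) i j = M i (revZ j) := by
  rw [Matrix.mul_apply, Finset.sum_eq_single (revZ j)]
  · simp [block, Jmid, J, revZ]
  · intro b _ hb
    have : b.1 ≠ j.1.rev := fun h => hb (Subtype.ext h)
    simp [block, Jmid, J, this]
  · simp

theorem Jmid_mul_block_transpose_apply (i j : Z n r) :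
    (Jmid R n r * (block M (Z n r) (Z n r)).transpose) i j = M j (revZ i) := by
  rw [Matrix.mul_apply, Finset.sum_eq_single (revZ i)]
  · simp [block, Jmid, J, revZ]
  · intro b _ hb
    have : i.1 ≠ b.1.rev := fun h => hb (Subtype.ext (by simp [h, revZ]))
    simp [block, Jmid, J, this]
  · simp

theorem block_mul_Jout_apply (i : Z n r) (c : lo n r) (hc : c.1.rev ∈ hi n r) :
    (block M (Z n r) (hi n r) * Jout R n r) i c = M i c.1.rev := by
  rw [Matrix.mul_apply, Finset.sum_eq_single ⟨c.1.rev, hc⟩]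
  · simp [block, Jout, J]
  · intro b _ hb
    have : b.1 ≠ c.1.rev := fun h => hb (Subtype.ext h)
    simp [block, Jout, J, this]
  · simp

theorem sum_lo_eq_sum_halfZc {T : Type*} [AddCommMonoid T] (f : Fin (2 * n) → T) :
    ∑ c ∈ lo n r, f c = ∑ c ∈ halfZc n r, f c := by
  have hlo : lo n r = (Zc n r).filter fun c : Fin (2 * n) => (c : ℕ) < n := by
    ext c
    simp only [lo, Finset.mem_filter, Finset.mem_univ, true_and, mem_Zc]
    omega
  rw [hlo, halfZc, Finset.sum_filter, Finset.sum_filter,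
    ← Finset.sum_coe_sort (Zc n r) fun c : Fin (2 * n) => if (c : ℕ) < n then f c else 0]

theorem block_mul_Jout_mul_transpose_apply (i j : Z n r) :
    (block M (Z n r) (hi n r) * Jout R n r * (block M (Z n r) (lo n r)).transpose) i j =
      ∑ c ∈ halfZc n r, M i (revZc c) * M j c := by
  have hrev (c : lo n r) : c.1.rev ∈ hi n r := by
    have := (Finset.mem_filter.1 c.2).2
    simp only [hi, Finset.mem_filter, Finset.mem_univ, true_and, Fin.val_rev]
    omega
  calc _ = ∑ c : lo n r, M i c.1.rev * M j c := by
        rw [Matrix.mul_apply]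
        exact Finset.sum_congr rfl fun c _ => by rw [block_mul_Jout_apply M i c (hrev c)]; rfl
    _ = ∑ c ∈ halfZc n r, M i (revZc c) * M j c := by
        rw [Finset.sum_coe_sort (lo n r) fun c => M i c.rev * M j c, sum_lo_eq_sum_halfZc]
        rfl

end Antidiagonal

section FiberPoint

theorem map_block {α R S : Type*} (f : R → S) (M : Matrix α α R) (s t : Finset α) :
    (block M s t).map f = block (M.map f) s t :=
  rfl

theorem sum_mul_mul_mul_comm {ι R : Type*} [CommRing R] (s : Finset ι) (f g : ι → R) (x y : R) :
    ∑ a ∈ s, f a * x * (g a * y) = (∑ a ∈ s, f a * g a) * (x * y) := by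
  simp only [Finset.sum_mul, mul_mul_mul_comm (f _) x]

variable {n r : ℕ} {R S F : Type*} [CommRing R] [CommRing S] [FunLike F R S] [RingHomClass F R S]

theorem entries_subset_ker_iff {φ : F} {α β : Type*} {M : Matrix α β R} :
    entries M ⊆ RingHom.ker φ ↔ M.map φ = 0 := by
  constructor
  · exact fun h => Matrix.ext fun i j => RingHom.mem_ker.1 (h ⟨i, j, rfl⟩)
  · rintro h _ ⟨i, j, rfl⟩
    exact RingHom.mem_ker.2 (congrFun₂ h i j)

theorem map_S₀ (φ : F) : (S₀ R n r).map φ = S₀ S n r :=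
  Matrix.ext fun i j => by simp [S₀, apply_ite φ]

theorem map_S₁ (φ : F) : (S₁ R n r).map φ = S₁ S n r :=
  Matrix.ext fun i j => by simp [S₁, apply_ite φ]

theorem map_Jmid (φ : F) : (Jmid R n r).map φ = Jmid S n r :=
  Matrix.ext fun i j => by simp [Jmid, block, J, apply_ite φ]

theorem map_Jout (φ : F) : (Jout R n r).map φ = Jout S n r :=
  Matrix.ext fun i j => by simp [Jout, block, J, apply_ite φ]

/-- The matrix `M` satisfies the equations of the chart with `π` replaced by `0`. -/
structure IsFiberPoint {T : Type*} [CommRing T] (n r : ℕ)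
    (M : Matrix (Fin (2 * n)) (Fin (2 * n)) T) : Prop where
  sq : M * M = 0
  minors : MinorsVanish M
  form₀ : M.transpose * S₀ T n r * M = 0
  form₁ : M.transpose * S₁ T n r * M + (2 : T) • (S₀ T n r * M) = 0
  trace : M.trace = 0
  traceA : (block M (Z n r) (Z n r)).trace = 0
  symm : block M (Z n r) (Z n r) * Jmid T n r = Jmid T n r * (block M (Z n r) (Z n r)).transpose
  middle : block M (Z n r) (hi n r) * Jout T n r * (block M (Z n r) (lo n r)).transpose =
    block M (Z n r) (Z n r) * Jmid T n r

variable {O T : Type*} [CommRing O] [CommRing T] [Algebra O T] {π : O}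

theorem map_genX (M : Matrix (Fin (2 * n)) (Fin (2 * n)) T) :
    (genX O n).map (MvPolynomial.aeval (R := O) fun p : Fin (2 * n) × Fin (2 * n) => M p.1 p.2) =
      M :=
  Matrix.ext fun i j => by simp [genX]

theorem idealNaive_le_ker_iff (hπ : algebraMap O T π = 0) {φ : PolyX O n →ₐ[O] T}
    {M : Matrix (Fin (2 * n)) (Fin (2 * n)) T} (hφ : (genX O n).map φ = M) :
    idealNaive π n r ≤ RingHom.ker φ ↔ M * M = 0 ∧ MinorsVanish M ∧
      M.transpose * S₀ T n r * M = 0 ∧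
      M.transpose * S₁ T n r * M + (2 : T) • (S₀ T n r * M) = 0 := by
  have hsmul (c : O) (N : Matrix (Fin (2 * n)) (Fin (2 * n)) (PolyX O n)) :
      (c • N).map φ = algebraMap O T c • N.map φ := by
    rw [Matrix.map_smul _ c (map_smul φ c), algebraMap_smul]
  simp only [idealNaive, Ideal.span_le, Set.union_subset_iff, entries_subset_ker_iff,
    minors_subset_ker_iff, Matrix.map_mul, Matrix.map_sub φ (map_sub φ),
    Matrix.map_add φ (map_add φ), hsmul, Matrix.transpose_map, map_S₀, map_S₁, hφ, map_mul, hπ,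
    mul_zero, zero_smul, sub_zero, add_zero, map_ofNat, and_assoc]

theorem idealAdd_le_ker_iff (hπ : algebraMap O T π = 0) {φ : PolyX O n →ₐ[O] T}
    {M : Matrix (Fin (2 * n)) (Fin (2 * n)) T} (hφ : (genX O n).map φ = M) :
    idealAdd π n r ≤ RingHom.ker φ ↔ M.trace = 0 ∧ (block M (Z n r) (Z n r)).trace = 0 ∧
      block M (Z n r) (Z n r) * Jmid T n r =
        Jmid T n r * (block M (Z n r) (Z n r)).transpose ∧
      block M (Z n r) (hi n r) * Jout T n r * (block M (Z n r) (lo n r)).transpose =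
        block M (Z n r) (Z n r) * Jmid T n r := by
  have hC : φ (MvPolynomial.C (2 * π)) = 0 := by
    rw [← MvPolynomial.algebraMap_eq, AlgHom.commutes, map_mul, hπ, mul_zero]
  simp only [idealAdd, blockA, blockB₁, blockB₂, Ideal.span_le, Set.union_subset_iff,
    Set.insert_subset_iff, Set.singleton_subset_iff, SetLike.mem_coe, RingHom.mem_ker,
    entries_subset_ker_iff, map_add, hC, add_zero, AddMonoidHom.map_trace, Matrix.map_mul,
    Matrix.map_sub φ (map_sub φ), Matrix.transpose_map, map_block, map_Jmid, map_Jout, hφ,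
    sub_eq_zero, and_assoc]

theorem isFiberPoint_iff (hπ : algebraMap O T π = 0) (M : Matrix (Fin (2 * n)) (Fin (2 * n)) T) :
    IsFiberPoint n r M ↔ idealNaive π n r ⊔ idealAdd π n r ≤
      RingHom.ker (MvPolynomial.aeval (R := O) fun p : Fin (2 * n) × Fin (2 * n) => M p.1 p.2) := by
  rw [sup_le_iff, idealNaive_le_ker_iff hπ (map_genX M), idealAdd_le_ker_iff hπ (map_genX M)]
  exact ⟨fun ⟨h₁, h₂, h₃, h₄, h₅, h₆, h₇, h₈⟩ => ⟨⟨h₁, h₂, h₃, h₄⟩, h₅, h₆, h₇, h₈⟩,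
    fun ⟨⟨h₁, h₂, h₃, h₄⟩, h₅, h₆, h₇, h₈⟩ => ⟨h₁, h₂, h₃, h₄, h₅, h₆, h₇, h₈⟩⟩

end FiberPoint

section RankOnePoint

variable {n r : ℕ} {T : Type*} [CommRing T]

/-- The extension of `u` from `Z` to all indices for which `IsFiberPoint` can hold for
`rankOneColumn u v * (rankOneRow u v)ᵗ`; the rows off `Z` are forced by
`Xᵗ S₁ X + 2 (S₀ X + π S₁ X) = 0` at `π = 0`. -/
def rankOneColumn (u : Z n r → T) (v : Zc n r → T) (i : Fin (2 * n)) : T :=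
  if h : i ∈ Z n r then u ⟨i, h⟩
  else -quadForm (halfZ n r) revZ u * v (revZc ⟨i, Finset.mem_compl.2 h⟩)

/-- The extension of `v` from `Zᶜ` to all indices that goes with `rankOneColumn`; the columns in
`Z` are forced by `B₂ J_{n-r} B₁ᵗ = A J_{2r}`. -/
def rankOneRow (u : Z n r → T) (v : Zc n r → T) (j : Fin (2 * n)) : T :=
  if h : j ∈ Z n r then quadForm (halfZc n r) revZc v * u (revZ ⟨j, h⟩)
  else v ⟨j, Finset.mem_compl.2 h⟩

variable (u : Z n r → T) (v : Zc n r → T)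

@[simp]
theorem rankOneColumn_Z (i : Z n r) : rankOneColumn u v i = u i :=
  dif_pos i.2

@[simp]
theorem rankOneColumn_Zc (i : Zc n r) :
    rankOneColumn u v i = -quadForm (halfZ n r) revZ u * v (revZc i) :=
  dif_neg (mem_Zc_iff_notMem_Z.1 i.2)

@[simp]
theorem rankOneRow_Z (j : Z n r) :
    rankOneRow u v j = quadForm (halfZc n r) revZc v * u (revZ j) :=
  dif_pos j.2

@[simp]
theorem rankOneRow_Zc (j : Zc n r) : rankOneRow u v j = v j :=
  dif_neg (mem_Zc_iff_notMem_Z.1 j.2)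

theorem sum_mul_revZ (u : Z n r → T) :
    ∑ a, u a * u (revZ a) = 2 * quadForm (halfZ n r) revZ u :=
  sum_mul_apply_eq_two_mul_quadForm involutive_revZ revZ_mem_halfZ u

theorem sum_mul_revZc (v : Zc n r → T) :
    ∑ a, v a * v (revZc a) = 2 * quadForm (halfZc n r) revZc v :=
  sum_mul_apply_eq_two_mul_quadForm involutive_revZc revZc_mem_halfZc v

theorem sum_Z_rankOneColumn_mul_rankOneRow :
    ∑ a : Z n r, rankOneColumn u v a * rankOneRow u v a =
      2 * (quadForm (halfZ n r) revZ u * quadForm (halfZc n r) revZc v) := by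
  simp only [rankOneColumn_Z, rankOneRow_Z, mul_left_comm (u _), ← Finset.mul_sum, sum_mul_revZ]
  ring

theorem sum_Zc_rankOneColumn_mul_rankOneRow :
    ∑ a : Zc n r, rankOneColumn u v a * rankOneRow u v a =
      -2 * (quadForm (halfZ n r) revZ u * quadForm (halfZc n r) revZc v) := by
  simp only [rankOneColumn_Zc, rankOneRow_Zc, mul_assoc, ← Finset.mul_sum, mul_comm (v (revZc _)),
    sum_mul_revZc]
  ring

theorem dotProduct_rankOneColumn_rankOneRow :
    rankOneRow u v ⬝ᵥ rankOneColumn u v = 0 := by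
  simp only [dotProduct, mul_comm (rankOneRow u v _)]
  rw [sum_eq_sum_Z_add_sum_Zc (r := r), sum_Z_rankOneColumn_mul_rankOneRow,
    sum_Zc_rankOneColumn_mul_rankOneRow]
  ring

theorem sum_Zc_rankOneColumn_mul_rankOneColumn :
    ∑ a : Zc n r, rankOneColumn u v a * rankOneColumn u v (revZc a) =
      quadForm (halfZ n r) revZ u ^ 2 * (2 * quadForm (halfZc n r) revZc v) := by
  have hterm (a : Zc n r) : rankOneColumn u v a * rankOneColumn u v (revZc a) =
      quadForm (halfZ n r) revZ u ^ 2 * (v a * v (revZc a)) := by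
    simp only [rankOneColumn_Zc, involutive_revZc _]
    ring
  simp only [hterm, ← Finset.mul_sum, sum_mul_revZc]

theorem isFiberPoint_rankOne
    (h : quadForm (halfZ n r) revZ u * quadForm (halfZc n r) revZc v = 0) :
    IsFiberPoint n r (Matrix.vecMulVec (rankOneColumn u v) (rankOneRow u v)) where
  sq := by
    rw [Matrix.vecMulVec_mul_vecMulVec, dotProduct_rankOneColumn_rankOneRow]
    simp
  minors := minorsVanish_vecMulVec _ _
  form₀ := by
    ext i j
    simp only [transpose_mul_S₀_mul_apply, Matrix.vecMulVec_apply, sum_mul_mul_mul_comm,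
      sum_Zc_rankOneColumn_mul_rankOneColumn, Matrix.zero_apply]
    linear_combination
      2 * quadForm (halfZ n r) revZ u * (rankOneRow u v i * rankOneRow u v j) * h
  form₁ := by
    ext i j
    simp only [Matrix.add_apply, Matrix.smul_apply, transpose_mul_S₁_mul_apply, S₀_mul_apply,
      Matrix.vecMulVec_apply, sum_mul_mul_mul_comm, rankOneColumn_Z, sum_mul_revZ, smul_eq_mul,
      Matrix.zero_apply]
    by_cases hi : i ∈ Z n r
    · rw [if_pos hi, rankOneRow_Z u v ⟨i, hi⟩]
      linear_combination 2 * u (revZ ⟨i, hi⟩) * rankOneRow u v j * h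
    · have hi' := mem_Zc_iff_notMem_Z.2 hi
      have hrev : rankOneColumn u v i.rev = -quadForm (halfZ n r) revZ u * v ⟨i, hi'⟩ := by
        rw [← involutive_revZc ⟨i, hi'⟩, ← rankOneColumn_Zc, revZc]
      rw [if_neg hi, rankOneRow_Zc u v ⟨i, hi'⟩, hrev]
      ring
  trace := by
    rw [Matrix.trace_vecMulVec, dotProduct_comm, dotProduct_rankOneColumn_rankOneRow]
  traceA := (sum_Z_rankOneColumn_mul_rankOneRow u v).trans (by rw [h, mul_zero])
  symm := by
    ext i j
    simp only [block_mul_Jmid_apply, Jmid_mul_block_transpose_apply, Matrix.vecMulVec_apply,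
      rankOneColumn_Z, rankOneRow_Z, involutive_revZ _]
    ring
  middle := by
    ext i j
    simp only [block_mul_Jmid_apply, block_mul_Jout_mul_transpose_apply, Matrix.vecMulVec_apply,
      rankOneColumn_Z, rankOneRow_Z, rankOneRow_Zc, involutive_revZ _, mul_mul_mul_comm (u i),
      ← Finset.mul_sum, mul_comm (v (revZc _))]
    rw [quadForm]
    ring

end RankOnePoint

section FiberEquations

variable {n r : ℕ} {T : Type*} [CommRing T] {M : Matrix (Fin (2 * n)) (Fin (2 * n)) T}

theorem IsFiberPoint.middle_apply (hM : IsFiberPoint n r M) (i j : Z n r) :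
    ∑ c ∈ halfZc n r, M i (revZc c) * M j c = M i (revZ j) := by
  rw [← block_mul_Jout_mul_transpose_apply, hM.middle, block_mul_Jmid_apply]

theorem IsFiberPoint.sum_sum_eq_zero (hM : IsFiberPoint n r M) (h2 : IsUnit (2 : T)) :
    ∑ a ∈ halfZ n r, ∑ c ∈ halfZc n r, M a (revZc c) * M (revZ a) c = 0 := by
  have hdiag (a : Z n r) : M a a = ∑ c ∈ halfZc n r, M a (revZc c) * M (revZ a) c := by
    rw [hM.middle_apply, involutive_revZ a]
  have hdiag' (a : Z n r) :
      M (revZ a) (revZ a) = ∑ c ∈ halfZc n r, M a (revZc c) * M (revZ a) c := by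
    rw [← hM.middle_apply]
    exact Finset.sum_congr rfl fun c _ => by rw [mul_comm, hM.minors]
  have htrace : ∑ a : Z n r, M a a = 0 := hM.traceA
  rw [sum_eq_sum_half involutive_revZ revZ_mem_halfZ fun a : Z n r => M a a] at htrace
  simp only [hdiag', hdiag, ← two_mul, ← Finset.mul_sum] at htrace
  exact h2.mul_right_eq_zero.1 htrace

theorem IsFiberPoint.quad_mul_quad (hM : IsFiberPoint n r M) (h2 : IsUnit (2 : T))
    (i j s t : Fin (2 * n)) :
    (∑ a ∈ halfZ n r, M a s * M (revZ a) t) * ∑ c ∈ halfZc n r, M i c * M j (revZc c) = 0 := by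
  have hterm (a : Z n r) (c : Zc n r) : M a s * M (revZ a) t * (M i c * M j (revZc c)) =
      M j s * M i t * (M a (revZc c) * M (revZ a) c) := by
    linear_combination (M (revZ a) t * M i c) * hM.minors a j s (revZc c) +
      M a (revZc c) * M j s * hM.minors (revZ a) i t c
  simp only [Finset.sum_mul_sum, hterm, ← Finset.mul_sum, hM.sum_sum_eq_zero h2, mul_zero]

theorem IsFiberPoint.entry_mem {k : Type*} [CommRing k] [Algebra k T] (hM : IsFiberPoint n r M)
    (h2 : IsUnit (2 : k)) {A : Subalgebra k T} (hA : ∀ (i : Z n r) (j : Zc n r), M i j ∈ A)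
    (i j : Fin (2 * n)) : M i j ∈ A := by
  have hZ (i : Z n r) (j : Fin (2 * n)) : M i j ∈ A := by
    by_cases hj : j ∈ Z n r
    · have hmid := hM.middle_apply i (revZ ⟨j, hj⟩)
      rw [involutive_revZ] at hmid
      exact hmid ▸ A.sum_mem fun c _ => A.mul_mem (hA _ _) (hA _ _)
    · exact hA i ⟨j, mem_Zc_iff_notMem_Z.2 hj⟩
  by_cases hi : i ∈ Z n r
  · exact hZ ⟨i, hi⟩ j
  · have hform := congrFun₂ hM.form₁ i.rev j
    have hrev : i.rev ∉ Z n r := fun h => hi (by simpa using rev_mem_Z h)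
    rw [Matrix.add_apply, Matrix.smul_apply, transpose_mul_S₁_mul_apply, S₀_mul_apply, if_neg hrev,
      Fin.rev_rev, Matrix.zero_apply] at hform
    have hmem : (2 : k) • M i j ∈ A := by
      rw [← algebraMap_smul T, map_ofNat, eq_neg_of_add_eq_zero_right hform]
      exact A.neg_mem (A.sum_mem fun a _ => A.mul_mem (hZ _ _) (hZ _ _))
    exact ((Subalgebra.toSubmodule A).smul_mem_iff_of_isUnit h2).1 hmem

end FiberEquations

section SpecialFiber

open MvPolynomial

variable {O : Type*} [CommRing O] [IsLocalRing O] {π : O} {n r : ℕ}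

local notation "κ" => IsLocalRing.ResidueField O

/-- The tautological matrix over the coordinate ring of the special fiber. -/
def fiberMatrix (π : O) (n r : ℕ) :
    Matrix (Fin (2 * n)) (Fin (2 * n)) (SpecialFiberRing π n r) :=
  Matrix.of fun i j => (1 : κ) ⊗ₜ[O]
    Ideal.Quotient.mk (idealNaive π n r ⊔ idealAdd π n r) (genX O n i j)

theorem fromB_genB (i : Z n r) (j : Zc n r) :
    fromB π n r (genB κ n r i j) = fiberMatrix π n r i j := by
  simp [fromB, fiberMatrix, genB]

theorem algebraMap_eq_zero_of_not_isUnit {T : Type*} [CommRing T] [Algebra O T] [Algebra κ T]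
    [IsScalarTower O κ T] (hπ : ¬ IsUnit π) : algebraMap O T π = 0 := by
  rw [IsScalarTower.algebraMap_apply O κ T, IsLocalRing.ResidueField.algebraMap_eq,
    (IsLocalRing.residue_eq_zero_iff π).2 ((IsLocalRing.mem_maximalIdeal π).2 hπ), map_zero]

theorem aeval_fiberMatrix :
    (aeval (R := O) fun p : Fin (2 * n) × Fin (2 * n) => fiberMatrix π n r p.1 p.2) =
      (Algebra.TensorProduct.includeRight : _ →ₐ[O] SpecialFiberRing π n r).comp
        (Ideal.Quotient.mkₐ O (idealNaive π n r ⊔ idealAdd π n r)) :=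
  MvPolynomial.algHom_ext fun p => by simp [fiberMatrix, genX]

theorem isFiberPoint_fiberMatrix (hπ : ¬ IsUnit π) : IsFiberPoint n r (fiberMatrix π n r) := by
  rw [isFiberPoint_iff (algebraMap_eq_zero_of_not_isUnit hπ), aeval_fiberMatrix]
  intro p hp
  rw [RingHom.mem_ker, AlgHom.comp_apply, Ideal.Quotient.mkₐ_eq_mk,
    Ideal.Quotient.eq_zero_iff_mem.2 hp, map_zero]

theorem exists_algHom_of_isFiberPoint {T : Type*} [CommRing T] [Algebra O T] [Algebra κ T]
    [IsScalarTower O κ T] (hπ : ¬ IsUnit π) {M : Matrix (Fin (2 * n)) (Fin (2 * n)) T}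
    (hM : IsFiberPoint n r M) :
    ∃ f : SpecialFiberRing π n r →ₐ[κ] T, (fiberMatrix π n r).map f = M := by
  rw [isFiberPoint_iff (algebraMap_eq_zero_of_not_isUnit hπ)] at hM
  refine ⟨Algebra.TensorProduct.lift (Algebra.ofId κ T) (Ideal.Quotient.liftₐ _ _ hM)
    fun _ _ => Commute.all _ _, Matrix.ext fun i j => ?_⟩
  rw [Matrix.map_apply, fiberMatrix, Matrix.of_apply, Algebra.TensorProduct.lift_tmul, map_one,
    one_mul]
  exact (Ideal.Quotient.lift_mk _ _ _).trans (by simp [genX])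

theorem adjoin_entries_fiberMatrix :
    Algebra.adjoin κ (entries (fiberMatrix π n r)) = ⊤ := by
  have hquot : Algebra.adjoin O (Ideal.Quotient.mkₐ O (idealNaive π n r ⊔ idealAdd π n r) ''
      Set.range (X (R := O))) = ⊤ := by
    rw [← AlgHom.map_adjoin, adjoin_range_X, Algebra.map_top, AlgHom.range_eq_top]
    exact Ideal.Quotient.mkₐ_surjective _ _
  rw [← top_le_iff, ← Algebra.TensorProduct.adjoin_one_tmul_image_eq_top _ hquot]
  refine Algebra.adjoin_mono ?_
  rintro _ ⟨_, ⟨_, ⟨⟨i, j⟩, rfl⟩, rfl⟩, rfl⟩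
  exact ⟨i, j, rfl⟩

theorem fromB_surjective (hπ : ¬ IsUnit π) (h2 : (2 : κ) ≠ 0) :
    Function.Surjective (fromB π n r) := by
  rw [← AlgHom.range_eq_top, ← top_le_iff, ← adjoin_entries_fiberMatrix, Algebra.adjoin_le_iff]
  rintro _ ⟨i, j, rfl⟩
  exact (isFiberPoint_fiberMatrix hπ).entry_mem (A := (fromB π n r).range) h2.isUnit
    (fun i j => ⟨genB κ n r i j, fromB_genB i j⟩) i j

theorem ker_fromB_le_ker_rankOneHom {T : Type*} [CommRing T] [Algebra κ T] (hπ : ¬ IsUnit π)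
    {u : Z n r → T} {v : Zc n r → T}
    (h : quadForm (halfZ n r) revZ u * quadForm (halfZc n r) revZc v = 0) :
    RingHom.ker (fromB π n r) ≤ RingHom.ker (rankOneHom (k := κ) (Equiv.refl _) u v) := by
  let _ : Algebra O T := Algebra.compHom T (algebraMap O κ)
  have : IsScalarTower O κ T := IsScalarTower.of_algebraMap_eq fun _ => rfl
  obtain ⟨f, hf⟩ := exists_algHom_of_isFiberPoint hπ (isFiberPoint_rankOne u v h)
  have hcomp : f.comp (fromB π n r) = rankOneHom (k := κ) (Equiv.refl _) u v := by
    refine MvPolynomial.algHom_ext fun ⟨i, j⟩ => ?_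
    have hgen : X (i, j) = genB κ n r i j := rfl
    have hgen' : genB κ n r i j = genericMatrix κ (Equiv.refl _) i j := rfl
    rw [AlgHom.comp_apply, hgen, fromB_genB, ← Matrix.map_apply (f := f), hf, hgen',
      rankOneHom_genericMatrix, Matrix.vecMulVec_apply, rankOneColumn_Z, rankOneRow_Zc]
  intro p hp
  rw [RingHom.mem_ker, ← hcomp, AlgHom.comp_apply, RingHom.mem_ker.1 hp, map_zero]

theorem minors_genB_subset_ker_fromB (hπ : ¬ IsUnit π) :
    minors (genB κ n r) ⊆ RingHom.ker (fromB π n r) := by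
  rintro _ ⟨i, i', j, j', rfl⟩
  simp only [SetLike.mem_coe, RingHom.mem_ker, map_sub, map_mul, fromB_genB]
  exact sub_eq_zero.2 ((isFiberPoint_fiberMatrix hπ).minors _ _ _ _)

theorem quad_mul_quad_mem_ker_fromB (hπ : ¬ IsUnit π) (h2 : (2 : κ) ≠ 0) (i j : Z n r)
    (s t : Zc n r) :
    (∑ a ∈ halfZ n r, genB κ n r a s * genB κ n r (revZ a) t) *
      (∑ c ∈ halfZc n r, genB κ n r i c * genB κ n r j (revZc c)) ∈
        RingHom.ker (fromB π n r) := by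
  have h2' : IsUnit (2 : SpecialFiberRing π n r) := by
    simpa only [map_ofNat] using h2.isUnit.map (algebraMap κ (SpecialFiberRing π n r))
  simp only [RingHom.mem_ker, map_mul, map_sum, fromB_genB]
  exact (isFiberPoint_fiberMatrix hπ).quad_mul_quad h2' i j s t

end SpecialFiber

section IrreducibleComponents

variable {P S : Type*} [CommRing P] [CommRing S]

theorem topologicalKrullDim_zeroLocus (J : Ideal S) :
    topologicalKrullDim (PrimeSpectrum.zeroLocus (J : Set S)) = ringKrullDim (S ⧸ J) := by
  have hmk : Function.Surjective (Ideal.Quotient.mk J) := Ideal.Quotient.mk_surjective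
  have hrange : Set.range (PrimeSpectrum.comap (Ideal.Quotient.mk J)) =
      PrimeSpectrum.zeroLocus (J : Set S) := by
    rw [range_comap_of_surjective _ _ hmk, Ideal.mk_ker]
  rw [← PrimeSpectrum.topologicalKrullDim_eq_ringKrullDim, ← hrange]
  exact (PrimeSpectrum.isClosedEmbedding_comap_of_surjective _ _ hmk).isEmbedding.toHomeomorph
    |>.isHomeomorph.topologicalKrullDim_eq.symm

variable {f : P →+* S}

theorem comap_map_of_ker_le (hf : Function.Surjective f) {I : Ideal P} (hI : RingHom.ker f ≤ I) :
    (I.map f).comap f = I := by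
  rw [Ideal.comap_map_of_surjective' f hf, sup_eq_left.2 hI]

theorem topologicalKrullDim_zeroLocus_image (hf : Function.Surjective f) {I : Ideal P}
    (hI : RingHom.ker f ≤ I) :
    topologicalKrullDim (PrimeSpectrum.zeroLocus (f '' (I : Set P))) = ringKrullDim (P ⧸ I) := by
  have hs : Function.Surjective ((Ideal.Quotient.mk (I.map f)).comp f) :=
    Ideal.Quotient.mk_surjective.comp hf
  have hker : RingHom.ker ((Ideal.Quotient.mk (I.map f)).comp f) = I := by
    rw [← RingHom.comap_ker, Ideal.mk_ker, comap_map_of_ker_le hf hI]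
  rw [← PrimeSpectrum.zeroLocus_span, ← Ideal.map, topologicalKrullDim_zeroLocus]
  exact (ringKrullDim_eq_of_ringEquiv ((Ideal.quotEquivOfEq hker.symm).trans
    (RingHom.quotientKerEquivOfSurjective hs))).symm

variable {ι : Type*} {I : ι → Ideal P}

theorem minimalPrimes_eq_range {J : Ideal P} (hprime : ∀ c, (I c).IsPrime)
    (hle : ∀ Q : Ideal P, Q.IsPrime → (J ≤ Q ↔ ∃ c, I c ≤ Q))
    (hanti : ∀ c c', I c ≤ I c' → c = c') : J.minimalPrimes = Set.range I := by
  have hJ (c : ι) : J ≤ I c := (hle (I c) (hprime c)).2 ⟨c, le_rfl⟩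
  ext Q
  constructor
  · rintro ⟨⟨hQ, hJQ⟩, hmin⟩
    obtain ⟨c, hc⟩ := (hle Q hQ).1 hJQ
    exact ⟨c, hc.antisymm (hmin ⟨hprime c, hJ c⟩ hc)⟩
  · rintro ⟨c, rfl⟩
    refine ⟨⟨hprime c, hJ c⟩, fun Q ⟨hQ, hJQ⟩ hQc => ?_⟩
    obtain ⟨c', hc'⟩ := (hle Q hQ).1 hJQ
    obtain rfl := hanti c' c (hc'.trans hQc)
    exact hc'

theorem range_zeroLocus_image (hf : Function.Surjective f)
    (hI : (RingHom.ker f).minimalPrimes = Set.range I) :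
    (Set.range fun c => PrimeSpectrum.zeroLocus (f '' (I c : Set P))) =
      irreducibleComponents (PrimeSpectrum S) := by
  have hmin : minimalPrimes S = Set.range fun c => (I c).map f := by
    have h := Ideal.minimalPrimes_map_of_surjective hf ⊥
    rwa [Ideal.map_bot, bot_sup_eq, hI, ← Set.range_comp] at h
  rw [← PrimeSpectrum.zeroLocus_minimalPrimes, hmin, ← Set.range_comp]
  exact congrArg Set.range (funext fun c => (PrimeSpectrum.zeroLocus_span _).symm)

theorem zeroLocus_image_injective (hf : Function.Surjective f)
    (hker : ∀ c, RingHom.ker f ≤ I c) (hprime : ∀ c, (I c).IsPrime)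
    (hI : Function.Injective I) :
    Function.Injective fun c => PrimeSpectrum.zeroLocus (f '' (I c : Set P)) := by
  have hrad (c : ι) : ((I c).map f).radical = (I c).map f :=
    have := hprime c
    (Ideal.map_isPrime_of_surjective hf (hker c)).radical
  intro c c' h
  have hmap : (I c).map f = (I c').map f := by
    rw [← hrad c, ← hrad c', ← PrimeSpectrum.zeroLocus_eq_iff, Ideal.map, Ideal.map,
      PrimeSpectrum.zeroLocus_span, PrimeSpectrum.zeroLocus_span]
    exact h
  apply hI
  rw [← comap_map_of_ker_le hf (hker c), hmap, comap_map_of_ker_le hf (hker c')]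

end IrreducibleComponents

section DefineComponents

variable {O : Type*} [CommRing O] [IsLocalRing O] {π : O} {n r m : ℕ}

local notation "κ" => IsLocalRing.ResidueField O

-- Replacing `fromB` by a variable keeps the unifier from unfolding the ring structure of
-- the tensor product.
theorem exists_ringHom_coe_eq_fromB (π : O) (n r : ℕ) :
    ∃ f : PolyB κ n r →+* SpecialFiberRing π n r,
      ⇑f = fromB π n r ∧ RingHom.ker f = RingHom.ker (fromB π n r) :=
  ⟨(fromB π n r).toRingHom, rfl, rfl⟩

theorem topologicalKrullDim_locus (hs : Function.Surjective (fromB π n r))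
    {J : Ideal (PolyB κ n r)} (hJ : RingHom.ker (fromB π n r) ≤ J) :
    topologicalKrullDim (locus π n r J) = ringKrullDim (PolyB κ n r ⧸ J) := by
  obtain ⟨f, hf, hker⟩ := exists_ringHom_coe_eq_fromB π n r
  rw [← hf] at hs
  rw [← hker] at hJ
  have h := topologicalKrullDim_zeroLocus_image (P := PolyB κ n r)
    (S := SpecialFiberRing π n r) (f := f) hs (I := J) hJ
  rwa [hf] at h

variable {I : Fin m → Ideal (PolyB (IsLocalRing.ResidueField O) n r)}

theorem locus_injective (hs : Function.Surjective (fromB π n r))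
    (hker : ∀ c, RingHom.ker (fromB π n r) ≤ I c) (hprime : ∀ c, (I c).IsPrime)
    (hI : Function.Injective I) : Function.Injective fun c => locus π n r (I c) := by
  obtain ⟨f, hf, hkerf⟩ := exists_ringHom_coe_eq_fromB π n r
  rw [← hf] at hs
  rw [← hkerf] at hker
  have h := zeroLocus_image_injective (P := PolyB κ n r) (S := SpecialFiberRing π n r) (f := f)
    hs (ι := Fin m) (I := I) hker hprime hI
  rwa [hf] at h

theorem range_locus (hs : Function.Surjective (fromB π n r))
    (hI : (RingHom.ker (fromB π n r)).minimalPrimes = Set.range I) :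
    (Set.range fun c => locus π n r (I c)) = irreducibleComponents (SpecialFiber π n r) := by
  obtain ⟨f, hf, hker⟩ := exists_ringHom_coe_eq_fromB π n r
  rw [← hf] at hs
  rw [← hker] at hI
  have h := range_zeroLocus_image (P := PolyB κ n r) (S := SpecialFiberRing π n r) (f := f)
    hs (ι := Fin m) (I := I) hI
  rwa [hf] at h

theorem defineComponents_of_le_iff (hs : Function.Surjective (fromB π n r))
    (hprime : ∀ c, (I c).IsPrime)
    (hle : ∀ Q : Ideal (PolyB κ n r), Q.IsPrime →
      (RingHom.ker (fromB π n r) ≤ Q ↔ ∃ c, I c ≤ Q))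
    (hanti : ∀ c c', I c ≤ I c' → c = c')
    (hdim : ∀ c, ringKrullDim (PolyB κ n r ⧸ I c) = ((2 * n - 2 : ℕ) : WithBot ℕ∞)) :
    DefineComponents π n r I := by
  have hker (c : Fin m) : RingHom.ker (fromB π n r) ≤ I c :=
    (hle (I c) (hprime c)).2 ⟨c, le_rfl⟩
  exact ⟨hs, hker, locus_injective hs hker hprime fun c c' h => hanti c c' h.le,
    range_locus hs (minimalPrimes_eq_range hprime hle hanti),
    fun c => (topologicalKrullDim_locus hs (hker c)).trans (hdim c), hprime⟩

theorem DefineComponents.ncard_irreducibleComponents (h : DefineComponents π n r I) :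
    (irreducibleComponents (SpecialFiber π n r)).ncard = m := by
  rw [← h.range_eq, Set.ncard_range_of_injective h.injective, Nat.card_eq_fintype_card,
    Fintype.card_fin]

end DefineComponents

section Compare

open MvPolynomial

variable {R α β σ : Type*} [CommRing R] {x : Matrix α β R} {L : Finset α} {τ : α → α} {a : α}
  {L' : Finset β} {τ' : β → β} {b : β}

theorem minors_transpose (x : Matrix α β R) : minors x.transpose = minors x := by
  ext f
  constructor
  all_goals
    rintro ⟨i, i', j, j', rfl⟩
    refine ⟨j, j', i, i', ?_⟩
    simp only [Matrix.transpose_apply]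
    ring

theorem minors_subset_rowIdeal {i i' : α} (hα : ∀ a, a = i ∨ a = i') :
    minors x ⊆ rowIdeal x i := by
  have hmem (j : β) : x i j ∈ rowIdeal x i := Ideal.subset_span ⟨j, rfl⟩
  rintro _ ⟨a, a', j, j', rfl⟩
  rcases hα a with rfl | rfl
  · exact sub_mem (Ideal.mul_mem_right _ _ (hmem j)) (Ideal.mul_mem_right _ _ (hmem j'))
  · rcases hα a' with rfl | rfl
    · exact sub_mem (Ideal.mul_mem_left _ _ (hmem j')) (Ideal.mul_mem_left _ _ (hmem j))
    · rw [mul_comm, sub_self]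
      exact zero_mem _

theorem quadIdeal_singleton_le_iff {Q : Ideal R} [hQ : Q.IsPrime] (hα : ∀ i, i = a ∨ i = τ a) :
    quadIdeal x {a} τ ≤ Q ↔ rowIdeal x a ≤ Q ∨ rowIdeal x (τ a) ≤ Q := by
  constructor
  · intro h
    rw [← hQ.mul_le]
    refine le_trans ?_ h
    rw [rowIdeal, rowIdeal, Ideal.span_mul_span', Ideal.span_le]
    rintro _ ⟨_, ⟨s, rfl⟩, _, ⟨t, rfl⟩, rfl⟩
    exact Ideal.subset_span
      (Or.inl ⟨s, t, (Finset.sum_singleton (fun a => x a s * x (τ a) t) a).symm⟩)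
  · have hle {i : α} (hi : ∀ s t, x a s * x (τ a) t ∈ rowIdeal x i)
        (hminors : minors x ⊆ rowIdeal x i) : quadIdeal x {a} τ ≤ rowIdeal x i := by
      refine Ideal.span_le.2 (Set.union_subset ?_ hminors)
      rintro _ ⟨s, t, rfl⟩
      rw [Finset.sum_singleton]
      exact hi s t
    rintro (h | h)
    · exact (hle (fun s _ => Ideal.mul_mem_right _ _ (Ideal.subset_span ⟨s, rfl⟩))
        (minors_subset_rowIdeal hα)).trans h
    · exact (hle (fun _ t => Ideal.mul_mem_left _ _ (Ideal.subset_span ⟨t, rfl⟩))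
        (minors_subset_rowIdeal fun i => (hα i).symm)).trans h

theorem quadIdeal_le_or_quadIdeal_transpose_le {Q : Ideal R} [hQ : Q.IsPrime]
    (hminors : minors x ⊆ Q)
    (hmul : ∀ s t i j, (∑ a ∈ L, x a s * x (τ a) t) * (∑ c ∈ L', x i c * x j (τ' c)) ∈ Q) :
    quadIdeal x L τ ≤ Q ∨ quadIdeal x.transpose L' τ' ≤ Q := by
  by_cases h : ∀ s t, ∑ a ∈ L, x a s * x (τ a) t ∈ Q
  · left
    refine Ideal.span_le.2 (Set.union_subset ?_ hminors)
    rintro _ ⟨s, t, rfl⟩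
    exact h s t
  · right
    push Not at h
    obtain ⟨s, t, hst⟩ := h
    refine Ideal.span_le.2 (Set.union_subset ?_ (by rwa [minors_transpose]))
    rintro _ ⟨i, j, rfl⟩
    exact (hQ.mem_or_mem (hmul s t i j)).resolve_left hst

theorem map_quadForm {S F : Type*} [CommRing S] [FunLike F R S] [RingHomClass F R S] (f : F)
    (L : Finset α) (τ : α → α) (u : α → R) :
    f (quadForm L τ u) = quadForm L τ fun a => f (u a) := by
  simp only [quadForm, map_sum, map_mul]

theorem IsPairing.eq_singleton (hL : IsPairing L τ) (ha : a ∈ L) (hα : ∀ i, i = a ∨ i = τ a) :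
    L = {a} :=
  Finset.eq_singleton_iff_unique_mem.2
    ⟨ha, fun i hi => (hα i).resolve_right (hL.ne hi ha)⟩

theorem IsPairing.quadForm_single [DecidableEq α] (hL : IsPairing L τ) (a : α) (c : R) :
    quadForm L τ (Pi.single a c) = 0 := by
  refine Finset.sum_eq_zero fun i hi => ?_
  by_cases h : i = a
  · subst h
    rw [Pi.single_eq_of_ne (hL.ne hi hi).symm, mul_zero]
  · rw [Pi.single_eq_of_ne h, zero_mul]

theorem IsPairing.quadForm_indicator (hL : IsPairing L τ) (ha : a ∈ L) :
    quadForm L τ (Set.indicator {a, τ a} (1 : α → R)) = 1 := by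
  rw [quadForm, Finset.sum_eq_single_of_mem a ha fun i hi hia => ?_]
  · simp
  · rw [Set.indicator_of_notMem (by simp [hia, hL.ne hi ha]), zero_mul]

/-- The names of the entries of the transposed matrix. -/
def swapEquiv (e : α × β ≃ σ) : β × α ≃ σ := (Equiv.prodComm β α).trans e

variable {k : Type*} [CommRing k] [Algebra k R]

theorem rankOneHom_swapEquiv (e : α × β ≃ σ) (u : α → R) (v : β → R) :
    rankOneHom (k := k) (swapEquiv e) v u = rankOneHom e u v :=
  algHom_ext fun c => by simp [rankOneHom, swapEquiv, mul_comm]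

theorem exists_quadIdeal_eq_ker_rankOneHom.{u, v, w, t} {k : Type u} [CommRing k] {α : Type v}
    {β : Type w} {σ : Type t} (e : α × β ≃ σ) (L : Finset α) (τ : α → α) :
    ∃ (D : Type (max u v w)) (_ : CommRing D) (_ : Algebra k D) (u : α → D) (v : β → D),
      quadForm L τ u = 0 ∧
        quadIdeal (genericMatrix k e) L τ = RingHom.ker (rankOneHom (k := k) e u v) := by
  let q := Ideal.Quotient.mkₐ k (Ideal.span {quadPoly k β L τ})
  refine ⟨_, inferInstance, inferInstance, fun i => q (X (Sum.inl i)), fun j => q (X (Sum.inr j)),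
    ?_, ?_⟩
  · have hq : q (quadPoly k β L τ) = 0 :=
      Ideal.Quotient.eq_zero_iff_mem.2 (Ideal.mem_span_singleton_self _)
    exact (map_quadForm q L τ _).symm.trans hq
  · have hcomp : rankOneHom e (fun i => q (X (Sum.inl i))) (fun j => q (X (Sum.inr j))) =
        q.comp (segre k e) :=
      algHom_ext fun c => by simp [rankOneHom, segre]
    rw [hcomp, ← comap_segre_span_quadPoly]
    ext p
    rw [RingHom.mem_ker, AlgHom.comp_apply, Ideal.Quotient.mkₐ_eq_mk,
      Ideal.Quotient.eq_zero_iff_mem, Ideal.mem_comap]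

theorem rowIdeal_le_ker_rankOneHom_iff (e : α × β ≃ σ) (i : α) (u : α → R) (v : β → R) :
    rowIdeal (genericMatrix k e) i ≤ RingHom.ker (rankOneHom (k := k) e u v) ↔
      ∀ j, u i * v j = 0 := by
  simp only [rowIdeal, Ideal.span_le, Set.range_subset_iff, SetLike.mem_coe, RingHom.mem_ker,
    rankOneHom_genericMatrix]

variable [Nontrivial k]

theorem not_quadIdeal_le_quadIdeal_swapEquiv (e : α × β ≃ σ) (hL : IsPairing L τ)
    (hL' : IsPairing L' τ') (ha : a ∈ L) (b : β) :
    ¬ quadIdeal (genericMatrix k e) L τ ≤ quadIdeal (genericMatrix k (swapEquiv e)) L' τ' := by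
  classical
  intro hle
  have h' := (quadIdeal_le_ker_rankOneHom_iff (k := k) (swapEquiv e) L' τ' (Pi.single b (1 : k))
    (Set.indicator {a, τ a} 1)).2 fun s t => by rw [hL'.quadForm_single, zero_mul]
  rw [rankOneHom_swapEquiv] at h'
  have h := (quadIdeal_le_ker_rankOneHom_iff e L τ _ _).1 (hle.trans h') b b
  rw [hL.quadForm_indicator ha] at h
  simp at h

theorem not_rowIdeal_le_rowIdeal (e : α × β ≃ σ) {i i' : α} (hi : i ≠ i') (b : β) :
    ¬ rowIdeal (genericMatrix k e) i ≤ rowIdeal (genericMatrix k e) i' := by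
  classical
  intro hle
  have h' := (rowIdeal_le_ker_rankOneHom_iff (k := k) e i' (Pi.single i (1 : k)) 1).2 fun j => by
    rw [Pi.single_eq_of_ne' hi, zero_mul]
  have h := (rowIdeal_le_ker_rankOneHom_iff e i _ _).1 (hle.trans h') b
  simp at h

theorem not_quadIdeal_swapEquiv_le_rowIdeal (e : α × β ≃ σ) (hL' : IsPairing L' τ') (hb : b ∈ L')
    {i i' : α} (hi : i ≠ i') :
    ¬ quadIdeal (genericMatrix k (swapEquiv e)) L' τ' ≤ rowIdeal (genericMatrix k e) i' := by
  classical
  intro hle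
  have h' := (rowIdeal_le_ker_rankOneHom_iff (k := k) e i' (Pi.single i (1 : k))
    (Set.indicator {b, τ' b} 1)).2 fun j => by rw [Pi.single_eq_of_ne' hi, zero_mul]
  rw [← rankOneHom_swapEquiv] at h'
  have h := (quadIdeal_le_ker_rankOneHom_iff (swapEquiv e) L' τ' _ _).1 (hle.trans h') i i
  rw [hL'.quadForm_indicator hb] at h
  simp at h

end Compare

section Ideals

variable {R α β : Type*} [CommRing R]

theorem span_le_union_minors [LinearOrder β] (x : Matrix α β R) (L : Finset α) (τ : α → α) :
    Ideal.span ({f | ∃ s t, s ≤ t ∧ f = ∑ a ∈ L, x a s * x (τ a) t} ∪ minors x) =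
      quadIdeal x L τ := by
  apply le_antisymm
  · refine Ideal.span_mono (Set.union_subset_union_left _ ?_)
    rintro _ ⟨s, t, -, rfl⟩
    exact ⟨s, t, rfl⟩
  · refine Ideal.span_le.2 (Set.union_subset ?_ fun f hf => Ideal.subset_span (Or.inr hf))
    rintro _ ⟨s, t, rfl⟩
    rcases le_total s t with hst | hts
    · exact Ideal.subset_span (Or.inl ⟨s, t, hst, rfl⟩)
    · -- Exchanging `s` and `t` changes each summand by a minor.
      have hsymm : ∑ a ∈ L, x a s * x (τ a) t = ∑ a ∈ L, x a t * x (τ a) s +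
          ∑ a ∈ L, (x a s * x (τ a) t - x a t * x (τ a) s) := by
        simp only [Finset.sum_sub_distrib, add_sub_cancel]
      rw [hsymm]
      exact Ideal.add_mem _ (Ideal.subset_span (Or.inl ⟨t, s, hts, rfl⟩))
        (Ideal.sum_mem _ fun a _ => Ideal.subset_span (Or.inr ⟨a, τ a, s, t, rfl⟩))

theorem span_row_eq_rowIdeal (x : Matrix α β R) {p : α → Prop} {i : α} (h : ∀ a, p a ↔ a = i) :
    Ideal.span {f | ∃ a b, p a ∧ f = x a b} = rowIdeal x i := by
  refine congrArg Ideal.span (Set.ext fun f => ⟨?_, ?_⟩)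
  · rintro ⟨a, b, ha, rfl⟩
    exact ⟨b, by rw [(h a).1 ha]⟩
  · rintro ⟨b, rfl⟩
    exact ⟨i, b, (h i).2 rfl, rfl⟩

theorem span_column_eq_rowIdeal (x : Matrix α β R) {p : β → Prop} {j : β}
    (h : ∀ b, p b ↔ b = j) :
    Ideal.span {f | ∃ a b, p b ∧ f = x a b} = rowIdeal x.transpose j :=
  (congrArg Ideal.span (Set.ext fun _ => exists_comm)).trans (span_row_eq_rowIdeal x.transpose h)

variable {n r : ℕ} (k : Type*) [CommRing k]

theorem idealMid₁_eq_quadIdeal :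
    idealMid₁ k n r = quadIdeal (genB k n r) (halfZ n r) revZ := by
  refine congrArg Ideal.span (congrArg (· ∪ _) (Set.ext fun f => ⟨?_, ?_⟩))
  · rintro ⟨t, s, rfl⟩
    exact ⟨s, revZc t, Finset.sum_congr rfl fun a _ => mul_comm _ _⟩
  · rintro ⟨s, t, rfl⟩
    refine ⟨revZc t, s, Finset.sum_congr rfl fun a _ => ?_⟩
    rw [involutive_revZc t, mul_comm]

theorem idealMid₂_eq_quadIdeal :
    idealMid₂ k n r = quadIdeal (genB k n r).transpose (halfZc n r) revZc := by
  rw [quadIdeal, minors_transpose]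
  refine congrArg Ideal.span (congrArg (· ∪ _) (Set.ext fun f => ⟨?_, ?_⟩))
  · rintro ⟨i, j, rfl⟩
    exact ⟨i, revZ j, rfl⟩
  · rintro ⟨i, j, rfl⟩
    refine ⟨i, revZ j, Finset.sum_congr rfl fun a _ => ?_⟩
    rw [involutive_revZ j]
    rfl

theorem idealLow₃_eq_quadIdeal :
    idealLow₃ k n r = quadIdeal (genB k n r).transpose (halfZc n r) revZc := by
  rw [← span_le_union_minors, minors_transpose]
  rfl

theorem idealHigh₃_eq_quadIdeal :
    idealHigh₃ k n r = quadIdeal (genB k n r) (halfZ n r) revZ :=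
  span_le_union_minors _ _ _

theorem idealLow₁_eq_rowIdeal {i : Z n r} (hi : (i.1 : ℕ) + 1 = n) :
    idealLow₁ k n r = rowIdeal (genB k n r) i :=
  span_row_eq_rowIdeal _ fun a => by rw [Subtype.ext_iff, Fin.ext_iff]; omega

theorem idealLow₂_eq_rowIdeal {i : Z n r} (hi : (i.1 : ℕ) = n) :
    idealLow₂ k n r = rowIdeal (genB k n r) i :=
  span_row_eq_rowIdeal _ fun a => by rw [Subtype.ext_iff, Fin.ext_iff]; omega

theorem idealHigh₁_eq_rowIdeal {j : Zc n r} (hj : (j.1 : ℕ) = 0) :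
    idealHigh₁ k n r = rowIdeal (genB k n r).transpose j :=
  span_column_eq_rowIdeal _ fun b => by rw [Subtype.ext_iff, Fin.ext_iff]; omega

theorem idealHigh₂_eq_rowIdeal {j : Zc n r} (hj : (j.1 : ℕ) + 1 = 2 * n) :
    idealHigh₂ k n r = rowIdeal (genB k n r).transpose j :=
  span_column_eq_rowIdeal _ fun b => by rw [Subtype.ext_iff, Fin.ext_iff]; omega

end Ideals

section Components

variable {O : Type*} [CommRing O] [IsLocalRing O] {π : O} {n r : ℕ}

local notation "κ" => IsLocalRing.ResidueField O
local notation "ε" => Equiv.refl (Z n r × Zc n r)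

theorem ker_fromB_le_iff (hπ : ¬ IsUnit π) (h2 : (2 : κ) ≠ 0) {Q : Ideal (PolyB κ n r)}
    [Q.IsPrime] :
    RingHom.ker (fromB π n r) ≤ Q ↔
      quadIdeal (genericMatrix κ ε) (halfZ n r) revZ ≤ Q ∨
        quadIdeal (genericMatrix κ (swapEquiv ε)) (halfZc n r) revZc ≤ Q := by
  refine ⟨fun h => ?_, ?_⟩
  · exact quadIdeal_le_or_quadIdeal_transpose_le ((minors_genB_subset_ker_fromB hπ).trans h)
      fun s t i j => h (quad_mul_quad_mem_ker_fromB hπ h2 i j s t)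
  rintro (h | h) <;> refine le_trans ?_ h
  · obtain ⟨D, _, _, u, v, hu, hker⟩ :=
      exists_quadIdeal_eq_ker_rankOneHom (k := κ) ε (halfZ n r) revZ
    rw [hker]
    exact ker_fromB_le_ker_rankOneHom hπ (by rw [hu, zero_mul])
  · obtain ⟨D, _, _, v, u, hv, hker⟩ :=
      exists_quadIdeal_eq_ker_rankOneHom (k := κ) (swapEquiv ε) (halfZc n r) revZc
    rw [hker, rankOneHom_swapEquiv]
    exact ker_fromB_le_ker_rankOneHom hπ (by rw [hv, mul_zero])

theorem defineComponents_mid (hπ : ¬ IsUnit π) (h2 : (2 : κ) ≠ 0) (hr : 2 ≤ r)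
    (hr' : r + 2 ≤ n) : DefineComponents π n r ![idealMid₁ κ n r, idealMid₂ κ n r] := by
  have hZ := halfZ_nontrivial hr (by omega : r ≤ n)
  have hZc := halfZc_nontrivial hr'
  obtain ⟨a, ha⟩ := hZ.nonempty
  obtain ⟨b, hb⟩ := hZc.nonempty
  have : Nonempty (Z n r) := ⟨a⟩
  have : Nonempty (Zc n r) := ⟨b⟩
  have h₁₂ := not_quadIdeal_le_quadIdeal_swapEquiv (k := κ) ε isPairing_halfZ isPairing_halfZc ha b
  have h₂₁ := not_quadIdeal_le_quadIdeal_swapEquiv (k := κ) (swapEquiv ε) isPairing_halfZc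
    isPairing_halfZ hb a
  have hcard : Nat.card (Z n r) + Nat.card (Zc n r) = 2 * n := by
    rw [card_Z (by omega), card_Zc (by omega)]
    omega
  rw [idealMid₁_eq_quadIdeal, idealMid₂_eq_quadIdeal]
  refine defineComponents_of_le_iff (fromB_surjective hπ h2)
    (Fin.forall_fin_two.2 ⟨isPrime_quadIdeal ε isPairing_halfZ hZ,
      isPrime_quadIdeal (swapEquiv ε) isPairing_halfZc hZc⟩)
    (fun Q _ => by rw [Fin.exists_fin_two]; exact ker_fromB_le_iff hπ h2) ?_
    (Fin.forall_fin_two.2 ⟨?_, ?_⟩)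
  · intro c c' h
    fin_cases c <;> fin_cases c'
    exacts [rfl, (h₁₂ h).elim, (h₂₁ h).elim, rfl]
  · exact (ringKrullDim_quotient_quadIdeal ε isPairing_halfZ hZ).trans (by rw [hcard])
  · exact (ringKrullDim_quotient_quadIdeal (swapEquiv ε) isPairing_halfZc hZc).trans
      (by rw [add_comm, hcard])

variable {α β : Type*} {L : Finset α} {τ : α → α} {a : α} {L' : Finset β} {τ' : β → β}

/-- The isotropic cone of a binary hyperbolic form is a union of two lines, so that the component
given by `L` splits into two linear ones. -/
theorem defineComponents_of_split [Finite α] [Finite β] (hs : Function.Surjective (fromB π n r))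
    (e : α × β ≃ Z n r × Zc n r) (hL : IsPairing L τ) (hL' : IsPairing L' τ') (ha : a ∈ L)
    (hα : ∀ i, i = a ∨ i = τ a) (hnt : L'.Nontrivial) (hβ : Nat.card β = 2 * n - 2)
    (hle : ∀ Q : Ideal (PolyB κ n r), Q.IsPrime → (RingHom.ker (fromB π n r) ≤ Q ↔
      quadIdeal (genericMatrix κ e) L τ ≤ Q ∨
        quadIdeal (genericMatrix κ (swapEquiv e)) L' τ' ≤ Q)) :
    DefineComponents π n r ![rowIdeal (genericMatrix κ e) a, rowIdeal (genericMatrix κ e) (τ a),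
      quadIdeal (genericMatrix κ (swapEquiv e)) L' τ'] := by
  have hne : a ≠ τ a := hL.ne ha ha
  have hα' (i : α) : i = τ a ∨ i = a := (hα i).symm
  have : Nonempty α := ⟨a⟩
  obtain ⟨b, hb⟩ := hnt.nonempty
  have hcard : Nat.card β + Nat.card α - 2 = 2 * n - 2 := by
    have hcα : Nat.card α = 2 :=
      Nat.card_eq_two_iff.2 ⟨a, τ a, hne, Set.eq_univ_of_forall hα⟩
    rw [hcα, hβ, Nat.add_sub_cancel]
  have hsplit (Q : Ideal (PolyB κ n r)) [Q.IsPrime] : quadIdeal (genericMatrix κ e) L τ ≤ Q ↔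
      rowIdeal (genericMatrix κ e) a ≤ Q ∨ rowIdeal (genericMatrix κ e) (τ a) ≤ Q := by
    rw [hL.eq_singleton ha hα, quadIdeal_singleton_le_iff hα]
  have hprime₁ := isPrime_rowIdeal (k := κ) e hne hα
  have hprime₂ := isPrime_rowIdeal (k := κ) e hne.symm hα'
  have hprime₃ := isPrime_quadIdeal (k := κ) (swapEquiv e) hL' hnt
  have h₃ := not_quadIdeal_le_quadIdeal_swapEquiv (k := κ) e hL hL' ha b
  rw [hsplit, not_or] at h₃
  refine defineComponents_of_le_iff hs ?_ ?_ ?_ ?_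
  · exact Fin.forall_fin_succ.2 ⟨hprime₁, Fin.forall_fin_two.2 ⟨hprime₂, hprime₃⟩⟩
  · intro Q hQ
    rw [hle Q hQ, hsplit, or_assoc, Fin.exists_fin_succ, Fin.exists_fin_two]
    rfl
  · have h₁₂ := not_rowIdeal_le_rowIdeal (k := κ) e hne b
    have h₂₁ := not_rowIdeal_le_rowIdeal (k := κ) e hne.symm b
    have h₃₁ := not_quadIdeal_swapEquiv_le_rowIdeal (k := κ) e hL' hb hne.symm
    have h₃₂ := not_quadIdeal_swapEquiv_le_rowIdeal (k := κ) e hL' hb hne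
    intro c c' h
    fin_cases c <;> fin_cases c'
    exacts [rfl, (h₁₂ h).elim, (h₃.1 h).elim, (h₂₁ h).elim, rfl, (h₃.2 h).elim, (h₃₁ h).elim,
      (h₃₂ h).elim, rfl]
  · refine Fin.forall_fin_succ.2 ⟨?_, Fin.forall_fin_two.2 ⟨?_, ?_⟩⟩
    · exact (ringKrullDim_quotient_rowIdeal e hne hα).trans (by rw [hβ])
    · exact (ringKrullDim_quotient_rowIdeal e hne.symm hα').trans (by rw [hβ])
    · exact (ringKrullDim_quotient_quadIdeal (swapEquiv e) hL' hnt).trans (by rw [hcard])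

theorem defineComponents_low (hπ : ¬ IsUnit π) (h2 : (2 : κ) ≠ 0) (hn : 3 ≤ n) (hr : r = 1) :
    DefineComponents π n r ![idealLow₁ κ n r, idealLow₂ κ n r, idealLow₃ κ n r] := by
  subst hr
  obtain ⟨a, ha⟩ : ∃ a : Z n 1, (a.1 : ℕ) + 1 = n :=
    ⟨⟨⟨n - 1, by omega⟩, mem_Z.2 (by simp only; omega)⟩, by simp only; omega⟩
  have hτ : ((revZ a).1 : ℕ) = n := by simp only [revZ, Fin.val_rev]; omega
  have hα (i : Z n 1) : i = a ∨ i = revZ a := by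
    have hi := mem_Z.1 i.2
    simp only [Subtype.ext_iff, Fin.ext_iff]
    omega
  rw [idealLow₁_eq_rowIdeal κ ha, idealLow₂_eq_rowIdeal κ hτ, idealLow₃_eq_quadIdeal]
  exact defineComponents_of_split (fromB_surjective hπ h2) (Equiv.refl _) isPairing_halfZ
    isPairing_halfZc (mem_halfZ.2 (by omega)) hα
    (halfZc_nontrivial (by omega)) (card_Zc (by omega)) fun Q _ => ker_fromB_le_iff hπ h2

theorem defineComponents_high (hπ : ¬ IsUnit π) (h2 : (2 : κ) ≠ 0) (hr : 2 ≤ r)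
    (hr' : r + 1 = n) :
    DefineComponents π n r ![idealHigh₁ κ n r, idealHigh₂ κ n r, idealHigh₃ κ n r] := by
  obtain ⟨a, ha⟩ : ∃ a : Zc n r, (a.1 : ℕ) = 0 :=
    ⟨⟨⟨0, by omega⟩, mem_Zc.2 (by simp only; omega)⟩, rfl⟩
  have hτ : ((revZc a).1 : ℕ) + 1 = 2 * n := by simp only [revZc, Fin.val_rev]; omega
  have hα (i : Zc n r) : i = a ∨ i = revZc a := by
    have hi := mem_Zc.1 i.2
    simp only [Subtype.ext_iff, Fin.ext_iff]
    omega
  rw [idealHigh₁_eq_rowIdeal κ ha, idealHigh₂_eq_rowIdeal κ hτ, idealHigh₃_eq_quadIdeal]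
  exact defineComponents_of_split (fromB_surjective hπ h2) (swapEquiv ε) isPairing_halfZc
    isPairing_halfZ (mem_halfZc.2 (by omega)) hα (halfZ_nontrivial hr (by omega))
    (by rw [card_Z (by omega)]; omega)
    fun Q _ => (ker_fromB_le_iff hπ h2).trans or_comm

end Components

end OrthogonalChart

end

theorem theorem7p1_general {O : Type*} [CommRing O] [IsLocalRing O]
    (h2 : ringChar (IsLocalRing.ResidueField O) ≠ 2) (π : O) (hπ : ¬ IsUnit π)
    (n r : ℕ) (hd : 5 ≤ 2 * n) :
    (r = 1 ∨ r = n - 1 →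
      (irreducibleComponents (OrthogonalChart.SpecialFiber π n r)).ncard = 3) ∧
    (1 < r ∧ r < n - 1 →
      (irreducibleComponents (OrthogonalChart.SpecialFiber π n r)).ncard = 2) ∧
    (r = 1 → OrthogonalChart.DefineComponents π n r
      ![OrthogonalChart.idealLow₁ _ n r, OrthogonalChart.idealLow₂ _ n r,
        OrthogonalChart.idealLow₃ _ n r]) ∧
    (r = n - 1 → OrthogonalChart.DefineComponents π n r
      ![OrthogonalChart.idealHigh₁ _ n r, OrthogonalChart.idealHigh₂ _ n r,
        OrthogonalChart.idealHigh₃ _ n r]) ∧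
    (1 < r ∧ r < n - 1 → OrthogonalChart.DefineComponents π n r
      ![OrthogonalChart.idealMid₁ _ n r, OrthogonalChart.idealMid₂ _ n r]) := by
  have h2' : (2 : IsLocalRing.ResidueField O) ≠ 0 := Ring.two_ne_zero h2
  have low (h : r = 1) :=
    OrthogonalChart.defineComponents_low (n := n) hπ h2' (by omega) h
  have high (h : r = n - 1) :=
    OrthogonalChart.defineComponents_high (n := n) (r := r) hπ h2' (by omega) (by omega)
  have mid (h : 1 < r ∧ r < n - 1) :=
    OrthogonalChart.defineComponents_mid (n := n) (r := r) hπ h2' (by omega) (by omega)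
  exact ⟨fun h => h.elim (fun h => (low h).ncard_irreducibleComponents)
    fun h => (high h).ncard_irreducibleComponents,
    fun h => (mid h).ncard_irreducibleComponents, low, high, mid⟩

theorem theorem7p1 {O : Type*} [CommRing O] [IsDomain O] [IsDiscreteValuationRing O]
    (h2 : ringChar (IsLocalRing.ResidueField O) ≠ 2) (π : O) (hπ : Irreducible π)
    (n r : ℕ) (hd : 5 ≤ 2 * n) (hl : 1 < 2 * r) (hl' : 2 * r + 1 < 2 * n) :
    (r = 1 ∨ r = n - 1 →
      (irreducibleComponents (OrthogonalChart.SpecialFiber π n r)).ncard = 3) ∧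
    (1 < r ∧ r < n - 1 →
      (irreducibleComponents (OrthogonalChart.SpecialFiber π n r)).ncard = 2) ∧
    (r = 1 → OrthogonalChart.DefineComponents π n r
      ![OrthogonalChart.idealLow₁ _ n r, OrthogonalChart.idealLow₂ _ n r,
        OrthogonalChart.idealLow₃ _ n r]) ∧
    (r = n - 1 → OrthogonalChart.DefineComponents π n r
      ![OrthogonalChart.idealHigh₁ _ n r, OrthogonalChart.idealHigh₂ _ n r,
        OrthogonalChart.idealHigh₃ _ n r]) ∧
    (1 < r ∧ r < n - 1 → OrthogonalChart.DefineComponents π n r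
      ![OrthogonalChart.idealMid₁ _ n r, OrthogonalChart.idealMid₂ _ n r]) := by
  exact theorem7p1_general h2 π hπ.not_isUnit n r hd
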